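/- **Effective asymptotic freeness of phased random permutations.** For $N\in\mathbb N$, a *random phased permutation* of dimension $N$ is the random unitary $N\times N$ matrix $\boldsymbol Z=\boldsymbol D_z\boldsymbol S$, where $\boldsymbol S$ is the matrix of a uniformly random permutation of $N$ elements and, independently, $\boldsymbol D_z=\mathrm{diag}(z_1,\dots,z_N)$ with $z_1,\dots,z_N$ i.i.d. Haar-distributed on $U(1)$. Fix integers $m,\ell,k\ge 0$ and distinct elements (words) $w_1,\dots,w_\ell$ of the free group on $m$ generators. For each $N$ let $\boldsymbol Z_1,\dots,\boldsymbol Z_m$ be i.i.d. random phased permutations of dimension $N$, and let $\boldsymbol W_i$ be the matrix obtained from $w_i$ by substituting $\boldsymbol Z_a$ for the $a$-th generator. Let $\boldsymbol Z'_1,\dots,\boldsymbol Z'_\ell$ be such that $\boldsymbol Z'_i=\boldsymbol I$ if $w_i$ is the trivial word, while the $\boldsymbol Z'_i$ with $w_i$ nontrivial are i.i.d. random phased permutations of dimension $N$. For $\vec j\in[\ell]^{2k}$ and a family $\{\boldsymbol V_i\}_{i=1}^\ell$ of random $N\times N$ matrices, define the following linear maps on operators on $(\mathbb C^N)^{\otimes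 k}$: $$\mathcal N_{\vec j,\{\boldsymbol V_i\}}[\boldsymbol X]=\mathbb E\,\big(\boldsymbol V_{j_1}\otimes\cdots\otimes\boldsymbol V_{j_k}\big)\,\boldsymbol X\,\big(\boldsymbol V_{j_{k+1}}^\dagger\otimes\cdots\otimes\boldsymbol V_{j_{2k}}^\dagger\big),\qquad \mathcal N_{2k,\boldsymbol Z}[\boldsymbol X]=\mathbb E\,\boldsymbol Z^{\otimes k}\boldsymbol X\,\boldsymbol Z^{\dagger\otimes k},$$ where $\boldsymbol Z$ is a random phased permutation of dimension $N$. Then, for every $\vec j\in[\ell]^{2k}$, $$\lim_{N\to\infty}\Big\|\mathcal N_{2k,\boldsymbol Z}\circ\big(\mathcal N_{\vec j,\{\boldsymbol W_i\}}-\mathcal N_{\vec j,\{\boldsymbol Z'_i\}}\big)\circ\mathcal N_{2k,\boldsymbol Z}\Big\|_\diamond=0 .$$ Here $\|\Phi\|_\diamond=\sup_{d\in\mathbb N}\ \sup_{\boldsymbol X\ne 0}\|(\Phi\otimes\mathrm{id}_d)[\boldsymbol X]\|_1/\|\boldsymbol X\|_1$ is the diamond norm, where $\boldsymbol X$ ranges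 over all nonzero operators on $(\mathbb C^N)^{\otimes k}\otimes\mathbb C^d$ and $\|\cdot\|_1$ is the trace norm. -/

import Mathlib

open MeasureTheory ProbabilityTheory Filter Topology
open scoped ENNReal Matrix

noncomputable section

namespace PhasedFreeness

/-! ### Random phased permutations -/

instance circleMeasurableSpace : MeasurableSpace Circle := borel Circle

instance circleBorelSpace : BorelSpace Circle := ⟨rfl⟩

instance permMeasurableSpace (N : ℕ) : MeasurableSpace (Equiv.Perm (Fin N)) := ⊤

instance permDiscreteMeasurableSpace (N : ℕ) :
    DiscreteMeasurableSpace (Equiv.Perm (Fin N)) := ⟨fun _ => trivial⟩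

/-- The data `(σ, z)` of a phased permutation `D_z S_σ` of dimension `N`. -/
abbrev PhasedPerm (N : ℕ) : Type := Equiv.Perm (Fin N) × (Fin N → Circle)

/-- The matrix `D_z S_σ`, where `D_z = diag(z)` and `S_σ` is the permutation matrix that sends
the basis vector `e_j` to `e_{σ j}`. -/
def PhasedPerm.toMatrix {N : ℕ} (p : PhasedPerm N) : Matrix (Fin N) (Fin N) ℂ :=
  Matrix.diagonal (fun i => (p.2 i : ℂ)) * Matrix.of (fun i j => if i = p.1 j then 1 else 0)

theorem PhasedPerm.toMatrix_apply {N : ℕ} (p : PhasedPerm N) (i j : Fin N) :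
    PhasedPerm.toMatrix p i j = if i = p.1 j then (p.2 i : ℂ) else 0 := by
  simp [PhasedPerm.toMatrix, Matrix.diagonal_mul]

theorem PhasedPerm.toMatrix_mem {N : ℕ} (p : PhasedPerm N) :
    PhasedPerm.toMatrix p ∈ Matrix.unitaryGroup (Fin N) ℂ := by
  rw [Matrix.mem_unitaryGroup_iff']
  ext a b
  simp only [Matrix.mul_apply, Matrix.star_apply, PhasedPerm.toMatrix_apply, Matrix.one_apply]
  rw [Finset.sum_eq_single (p.1 b)]
  · by_cases h : a = b
    · subst h
      have h1 : Complex.normSq (p.2 (p.1 a) : ℂ) = 1 := Circle.normSq_coe _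
      simp [← Complex.normSq_eq_conj_mul_self, h1]
    · have h2 : p.1 b ≠ p.1 a := fun e => h (p.1.injective e).symm
      simp [h, h2]
  · intro c _ hc
    simp [hc]
  · simp

/-- A phased permutation as a unitary matrix. -/
def PhasedPerm.toUnitary {N : ℕ} (p : PhasedPerm N) : Matrix.unitaryGroup (Fin N) ℂ :=
  ⟨PhasedPerm.toMatrix p, PhasedPerm.toMatrix_mem p⟩

/-- The law of a random phased permutation: a uniformly random permutation and, independently,
`N` i.i.d. phases distributed by the normalised Haar measure of the circle group `U(1)`. -/
def phasedPermLaw (N : ℕ) : Measure (PhasedPerm N) :=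
  (uniformOn (Set.univ : Set (Equiv.Perm (Fin N)))).prod
    (Measure.pi fun _ : Fin N => Measure.haarMeasure (⊤ : TopologicalSpace.PositiveCompacts Circle))

instance haarCircle_isProbabilityMeasure :
    IsProbabilityMeasure
      (Measure.haarMeasure (⊤ : TopologicalSpace.PositiveCompacts Circle)) :=
  ⟨by simpa using Measure.haarMeasure_self (K₀ := (⊤ : TopologicalSpace.PositiveCompacts Circle))⟩

instance uniformPerm_isProbabilityMeasure (N : ℕ) :
    IsProbabilityMeasure (uniformOn (Set.univ : Set (Equiv.Perm (Fin N)))) :=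
  isProbabilityMeasure_uniformOn Set.finite_univ Set.univ_nonempty

instance phasedPermLaw_isProbabilityMeasure (N : ℕ) :
    IsProbabilityMeasure (phasedPermLaw N) := by
  unfold phasedPermLaw
  infer_instance

/-- The law of `n` independent random phased permutations of dimension `N`. -/
def iidLaw (n N : ℕ) : Measure (Fin n → PhasedPerm N) :=
  Measure.pi fun _ => phasedPermLaw N

/-! ### Tensor products and superoperators on `(ℂ^N)^{⊗k}`

The space `(ℂ^N)^{⊗k}` has the product basis indexed by `Fin k → Fin N`. -/

/-- Operators on `(ℂ^N)^{⊗k}`. -/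
abbrev TensorOp (k N : ℕ) : Type := Matrix (Fin k → Fin N) (Fin k → Fin N) ℂ

/-- The tensor product `A_1 ⊗ ⋯ ⊗ A_k`. -/
def tensor {k N : ℕ} (A : Fin k → Matrix (Fin N) (Fin N) ℂ) : TensorOp k N :=
  Matrix.of fun x y => ∏ i, A i (x i) (y i)

/-- The superoperator `X ↦ 𝔼 A X Bᴴ` for random matrices `A`, `B`, written through its kernel
`𝔼 A_{x a} conj(B_{y b})`; see `averagedMap_apply`. -/
def averagedMap {Ω ι : Type*} [Fintype ι] [MeasurableSpace Ω] (μ : Measure Ω)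
    (A B : Ω → Matrix ι ι ℂ) : Matrix ι ι ℂ →ₗ[ℂ] Matrix ι ι ℂ where
  toFun X := Matrix.of fun x y => ∑ a, ∑ b, (∫ ω, A ω x a * star (B ω y b) ∂μ) * X a b
  map_add' X Y := by
    ext x y
    simp [mul_add, Finset.sum_add_distrib]
  map_smul' c X := by
    ext x y
    simp only [Matrix.of_apply, Matrix.smul_apply, smul_eq_mul, RingHom.id_apply, Finset.mul_sum]
    exact Finset.sum_congr rfl fun a _ => Finset.sum_congr rfl fun b _ => by ring

theorem averagedMap_apply {Ω ι : Type*} [Fintype ι] [MeasurableSpace Ω] (μ : Measure Ω)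
    (A B : Ω → Matrix ι ι ℂ)
    (h : ∀ x a y b, Integrable (fun ω => A ω x a * star (B ω y b)) μ)
    (X : Matrix ι ι ℂ) (x y : ι) :
    averagedMap μ A B X x y = ∫ ω, (A ω * X * (B ω)ᴴ) x y ∂μ := by
  have h1 : ∀ ω, (A ω * X * (B ω)ᴴ) x y = ∑ a, ∑ b, (A ω x a * star (B ω y b)) * X a b := by
    intro ω
    simp only [Matrix.mul_apply, Matrix.conjTranspose_apply, Finset.sum_mul]
    rw [Finset.sum_comm]
    exact Finset.sum_congr rfl fun a _ => Finset.sum_congr rfl fun b _ => by ring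
  have h2 : averagedMap μ A B X x y =
      ∑ a, ∑ b, (∫ ω, A ω x a * star (B ω y b) ∂μ) * X a b := rfl
  have h3 : ∫ ω, (A ω * X * (B ω)ᴴ) x y ∂μ =
      ∫ ω, ∑ a, ∑ b, (A ω x a * star (B ω y b)) * X a b ∂μ :=
    integral_congr_ae (Filter.Eventually.of_forall h1)
  have h4 : ∀ F : ι → ι → Ω → ℂ, (∀ a b, Integrable (F a b) μ) →
      ∫ ω, ∑ a, ∑ b, F a b ω ∂μ = ∑ a, ∑ b, ∫ ω, F a b ω ∂μ := by
    intro F hF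
    rw [integral_finsetSum _ fun a _ => integrable_finsetSum _ fun b _ => hF a b]
    exact Finset.sum_congr rfl fun a _ => integral_finsetSum _ fun b _ => hF a b
  refine h2.trans (Eq.symm (h3.trans ((h4 _ fun a b => (h x a y b).mul_const (X a b)).trans ?_)))
  exact Finset.sum_congr rfl fun a _ => Finset.sum_congr rfl fun b _ => integral_mul_const _ _

/-- For random matrices `V_1, …, V_ℓ` and `j ∈ [ℓ]^{2k}`, the mixed-moment map
`X ↦ 𝔼 (V_{j_1} ⊗ ⋯ ⊗ V_{j_k}) X (V_{j_{k+1}}ᴴ ⊗ ⋯ ⊗ V_{j_{2k}}ᴴ)`. -/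
def mixedMomentMap {Ω : Type*} [MeasurableSpace Ω] (μ : Measure Ω) {ℓ k N : ℕ}
    (V : Ω → Fin ℓ → Matrix (Fin N) (Fin N) ℂ) (j : Fin (k + k) → Fin ℓ) :
    TensorOp k N →ₗ[ℂ] TensorOp k N :=
  averagedMap μ (fun ω => tensor fun i => V ω (j (Fin.castAdd k i)))
    (fun ω => tensor fun i => V ω (j (Fin.natAdd k i)))

/-- The symmetrization `X ↦ 𝔼 Z^{⊗k} X (Zᴴ)^{⊗k}` by a random phased permutation `Z`. -/
def symmetrization (k N : ℕ) : TensorOp k N →ₗ[ℂ] TensorOp k N :=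
  averagedMap (phasedPermLaw N) (fun p => tensor fun _ => PhasedPerm.toMatrix p)
    (fun p => tensor fun _ => PhasedPerm.toMatrix p)

/-- The values of the words `w_1, …, w_ℓ` at the phased permutations `Z_1, …, Z_m`. -/
def evalWords {m ℓ N : ℕ} (w : Fin ℓ → FreeGroup (Fin m)) (Z : Fin m → PhasedPerm N)
    (i : Fin ℓ) : Matrix (Fin N) (Fin N) ℂ :=
  (FreeGroup.lift (fun a => PhasedPerm.toUnitary (Z a)) (w i) : Matrix.unitaryGroup (Fin N) ℂ)

/-- The replacements: `Z_i` if the word `w_i` is nontrivial, and the identity otherwise. -/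
def replaceWords {m ℓ N : ℕ} (w : Fin ℓ → FreeGroup (Fin m)) (Z : Fin ℓ → PhasedPerm N)
    (i : Fin ℓ) : Matrix (Fin N) (Fin N) ℂ :=
  if w i = 1 then 1 else PhasedPerm.toMatrix (Z i)

/-! ### The diamond norm -/

/-- The trace norm `tr |A|`: the sum of the singular values, which are the square roots of the
eigenvalues of `Aᴴ A`. -/
def traceNorm {ι : Type*} [Fintype ι] [DecidableEq ι] (A : Matrix ι ι ℂ) : ℝ :=
  ∑ i, Real.sqrt ((Matrix.isHermitian_conjTranspose_mul_self A).eigenvalues i)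

/-- `Φ ⊗ id` on operators on `ℂ^ι ⊗ ℂ^d`. -/
def tensorAncilla {ι : Type*} (Φ : Matrix ι ι ℂ →ₗ[ℂ] Matrix ι ι ℂ) (d : ℕ)
    (X : Matrix (ι × Fin d) (ι × Fin d) ℂ) : Matrix (ι × Fin d) (ι × Fin d) ℂ :=
  Matrix.of fun p q => Φ (Matrix.of fun x y => X (x, p.2) (y, q.2)) p.1 q.1

/-- The diamond norm: the supremum, over all finite ancilla dimensions `d`, of the induced
`1 → 1` norm of `Φ ⊗ id`. It is `[0, ∞]`-valued, so that the supremum needs no boundedness. -/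
def diamondNorm {ι : Type*} [Fintype ι] [DecidableEq ι]
    (Φ : Matrix ι ι ℂ →ₗ[ℂ] Matrix ι ι ℂ) : ℝ≥0∞ :=
  ⨆ (d : ℕ) (X : Matrix (ι × Fin d) (ι × Fin d) ℂ) (_ : X ≠ 0),
    ENNReal.ofReal (traceNorm (tensorAncilla Φ d X) / traceNorm X)

end PhasedFreeness

end

/-!
The symmetrization averages a matrix unit `|x⟩⟨y|` over random phases and over a random permutation
of the basis. The phase average kills it unless `y` is a rearrangement of `x`, and the permutation
average replaces it by the mean over all pairs with the same equality pattern among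
`x_1, …, x_k, y_1, …, y_k` (`symmetrization_eq_sum`). The number of patterns does not depend on
`N`. So the symmetrized difference of the two mixed-moment maps is a sum of boundedly many maps
`X ↦ g |c'|⁻¹ tr (O_cᵀ X) O_{c'}`, where `O_c` is the `0`-`1` matrix of the pattern class `c`. As
`y` is a rearrangement of `x`, each index occurs in at most one pair of `c`, and `O_c` is a partial
permutation matrix. By the duality of the trace norm and the operator norm, the diamond norm is then
at most `∑ |g|` (`diamondNorm_le_sum`).

The coefficient `g` is the mean over `(a, b) ∈ c` of the difference, between the two models, of
`𝔼 ∑_{(x, y) ∈ c'} ⟨x|V ⊗ ⋯ ⊗ V|a⟩ conj ⟨y|V ⊗ ⋯ ⊗ V|b⟩`. A word in phased permutations sends a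
basis vector to a unimodular multiple of a basis vector, so the sum has at most one nonzero term,
which belongs to the endpoints of the words started at the points of `a` and `b`. If distinct pairs
of word and starting point have distinct endpoints, then the pattern of the endpoints is
deterministic, and on a balanced pattern all phases cancel (`classSum_eq_of_generic`). Hence the sum
is then the same number for every family of distinct words, and the coefficient is at most a
constant times the probability of a coincidence. The replacements are themselves distinct words:
single generators, and the trivial word at most once (`injective_replacementWords`).

A coincidence of endpoints means that a word `u ≠ 1` in uniformly random permutations sends a given
point to a given point. Following the letters of the reduced word and revealing only the values that
are needed, each given new point is the next one with conditional probability at least `1/N`, and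
only boundedly many points are excluded. So the path avoids the excluded points with probability
`1 - O(1/N)` (`permLaw_word_eq_le`).
-/

noncomputable section

namespace PhasedFreeness

/-! ### Trace-norm duality -/

/-- Contractions, stated through the associated sesquilinear form: `|u* B v| ≤ ‖u‖ ‖v‖`. -/
def IsContraction {ι κ : Type*} [Fintype ι] [Fintype κ] (B : Matrix ι κ ℂ) : Prop :=
  ∀ (u : ι → ℂ) (v : κ → ℂ), ‖∑ p, ∑ q, star (u p) * B p q * v q‖ ≤
    √(∑ p, ‖u p‖ ^ 2) * √(∑ q, ‖v q‖ ^ 2)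

theorem norm_sum_mul_le_sqrt {ι : Type*} [Fintype ι] (u v : ι → ℂ) :
    ‖∑ p, u p * v p‖ ≤ √(∑ p, ‖u p‖ ^ 2) * √(∑ q, ‖v q‖ ^ 2) :=
  (norm_sum_le _ _).trans <| by
    simpa only [norm_mul] using
      Real.sum_mul_le_sqrt_mul_sqrt Finset.univ (fun i => ‖u i‖) (fun i => ‖v i‖)

theorem sum_star_mul_self {ι : Type*} [Fintype ι] (v : ι → ℂ) :
    star v ⬝ᵥ v = ((∑ p, ‖v p‖ ^ 2 : ℝ) : ℂ) := by
  simp [dotProduct, Complex.conj_mul']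

theorem sum_norm_sq_mulVec {ι κ : Type*} [Fintype ι] [Fintype κ] (A : Matrix ι κ ℂ) (v : κ → ℂ) :
    ((∑ p, ‖(A *ᵥ v) p‖ ^ 2 : ℝ) : ℂ) = star v ⬝ᵥ ((Aᴴ * A) *ᵥ v) := by
  rw [← sum_star_mul_self, Matrix.star_mulVec, ← Matrix.dotProduct_mulVec, Matrix.mulVec_mulVec]

/-- A matrix for which `B Bᴴ` is unitarily equivalent to a diagonal matrix with entries at most `1`
is a contraction. -/
theorem isContraction_of_mul_conjTranspose {ι : Type*} [Fintype ι] [DecidableEq ι]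
    (B U : Matrix ι ι ℂ) (hU : U * Uᴴ = 1) (e : ι → ℝ) (he1 : ∀ i, e i ≤ 1)
    (hB : B * Bᴴ = U * Matrix.diagonal (fun i => (e i : ℂ)) * Uᴴ) : IsContraction B := by
  intro u v
  have h1 : ∑ p, ∑ q, star (u p) * B p q * v q = ∑ q, star ((Bᴴ *ᵥ u) q) * v q := by
    rw [Finset.sum_comm]
    refine Finset.sum_congr rfl fun q _ => ?_
    simp [Matrix.mulVec, dotProduct, Finset.mul_sum, mul_comm, mul_left_comm]
  rw [h1]
  refine (norm_sum_mul_le_sqrt _ _).trans ?_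
  refine mul_le_mul_of_nonneg_right (Real.sqrt_le_sqrt ?_) (Real.sqrt_nonneg _)
  simp only [norm_star]
  have h2 : ((∑ p, ‖(Bᴴ *ᵥ u) p‖ ^ 2 : ℝ) : ℂ) = ((∑ i, e i * ‖(Uᴴ *ᵥ u) i‖ ^ 2 : ℝ) : ℂ) := by
    rw [sum_norm_sq_mulVec, Matrix.conjTranspose_conjTranspose, hB, Matrix.mul_assoc,
      ← Matrix.mulVec_mulVec, ← Matrix.mulVec_mulVec, Matrix.dotProduct_mulVec]
    have : star u ᵥ* U = star (Uᴴ *ᵥ u) := by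
      rw [Matrix.star_mulVec, Matrix.conjTranspose_conjTranspose]
    rw [this]
    simp only [dotProduct, Matrix.mulVec_diagonal, Pi.star_apply]
    push_cast
    refine Finset.sum_congr rfl fun i _ => ?_
    rw [← Complex.conj_mul']
    simp; ring
  have h3 : ((∑ p, ‖u p‖ ^ 2 : ℝ) : ℂ) = ((∑ i, ‖(Uᴴ *ᵥ u) i‖ ^ 2 : ℝ) : ℂ) := by
    rw [sum_norm_sq_mulVec, Matrix.conjTranspose_conjTranspose, hU, Matrix.one_mulVec,
      sum_star_mul_self]
  rw [Complex.ofReal_inj.1 h2, Complex.ofReal_inj.1 h3]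
  exact Finset.sum_le_sum fun i _ => mul_le_of_le_one_left (by positivity) (he1 i)

theorem traceNorm_nonneg {ι : Type*} [Fintype ι] [DecidableEq ι] (A : Matrix ι ι ℂ) :
    0 ≤ traceNorm A :=
  Finset.sum_nonneg fun _ _ => Real.sqrt_nonneg _

/-- The spectral decomposition of `Aᴴ A`, whose eigenvalues are the squared singular values. -/
theorem exists_unitary_conjTranspose_mul_self {ι : Type*} [Fintype ι] [DecidableEq ι]
    (A : Matrix ι ι ℂ) : ∃ (U : Matrix ι ι ℂ) (e : ι → ℝ), U * Uᴴ = 1 ∧ Uᴴ * U = 1 ∧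
      Aᴴ * A = U * Matrix.diagonal (fun i => (e i : ℂ)) * Uᴴ ∧ (∀ i, 0 ≤ e i) ∧
      traceNorm A = ∑ i, √(e i) := by
  have hA := Matrix.isHermitian_conjTranspose_mul_self A
  refine ⟨hA.eigenvectorUnitary, hA.eigenvalues,
    Matrix.mem_unitaryGroup_iff.1 hA.eigenvectorUnitary.2,
    Matrix.mem_unitaryGroup_iff'.1 hA.eigenvectorUnitary.2, ?_, ?_, rfl⟩
  · have := hA.spectral_theorem
    rwa [Unitary.conjStarAlgAut_apply] at this
  · open scoped ComplexOrder in
    exact (Matrix.posSemidef_conjTranspose_mul_self A).eigenvalues_nonneg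

/-- In an eigenbasis of `Aᴴ A`, the diagonal entries of `B A` are bounded by the singular values. -/
theorem norm_trace_mul_le_traceNorm {ι : Type*} [Fintype ι] [DecidableEq ι] (A B : Matrix ι ι ℂ)
    (hB : IsContraction B) : ‖(B * A).trace‖ ≤ traceNorm A := by
  obtain ⟨U, e, hU, hU', hs, hpos, htn⟩ := exists_unitary_conjTranspose_mul_self A
  have ht : (B * A).trace = (Uᴴ * (B * (A * U))).trace := by
    rw [Matrix.trace_mul_comm Uᴴ, Matrix.mul_assoc, Matrix.mul_assoc, hU, Matrix.mul_one]
  rw [ht, htn, Matrix.trace]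
  refine (norm_sum_le _ _).trans (Finset.sum_le_sum fun i _ => ?_)
  have hd : (Uᴴ * (B * (A * U))).diag i =
      ∑ p, ∑ q, star (U p i) * B p q * (A * U) q i := by
    simp [Matrix.diag_apply, Matrix.mul_apply (M := Uᴴ), Matrix.mul_apply (M := B),
      Finset.mul_sum, mul_assoc]
  rw [hd]
  refine (hB _ _).trans ?_
  have hG : (A * U)ᴴ * (A * U) = Matrix.diagonal (fun i => (e i : ℂ)) := by
    calc (A * U)ᴴ * (A * U) = Uᴴ * (Aᴴ * A) * U := by
          rw [Matrix.conjTranspose_mul]; simp only [Matrix.mul_assoc]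
      _ = (Uᴴ * U) * Matrix.diagonal (fun i => (e i : ℂ)) * (Uᴴ * U) := by
          rw [hs]; simp only [Matrix.mul_assoc]
      _ = _ := by rw [hU', Matrix.one_mul, Matrix.mul_one]
  have hcol : ∀ M : Matrix ι ι ℂ, ((∑ p, ‖M p i‖ ^ 2 : ℝ) : ℂ) = (Mᴴ * M) i i := by
    intro M
    simp [Matrix.mul_apply, Complex.conj_mul']
  have e1 : ∑ p, ‖U p i‖ ^ 2 = 1 := by
    apply Complex.ofReal_inj.1
    rw [hcol, hU']; simp
  have e2 : ∑ p, ‖(A * U) p i‖ ^ 2 = e i := by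
    apply Complex.ofReal_inj.1
    rw [hcol, hG]; simp
  rw [e1, e2, Real.sqrt_one, one_mul]

/-- The witness is the adjoint of the polar part of `A`. -/
theorem exists_isContraction_trace_mul_eq {ι : Type*} [Fintype ι] [DecidableEq ι]
    (A : Matrix ι ι ℂ) : ∃ B : Matrix ι ι ℂ, IsContraction B ∧ (B * A).trace = traceNorm A := by
  obtain ⟨U, e, hU, hU', hs, hpos, htn⟩ := exists_unitary_conjTranspose_mul_self A
  -- On the kernel of `A` the inverse is `0⁻¹ = 0`, so that `B` vanishes there.
  set s : ι → ℝ := fun i => (√(e i))⁻¹ with hsdef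
  set D : Matrix ι ι ℂ := Matrix.diagonal (fun i => (s i : ℂ)) with hD
  have hDH : Dᴴ = D := by
    rw [hD, Matrix.diagonal_conjTranspose]; congr 1; ext i; simp
  refine ⟨U * D * Uᴴ * Aᴴ, isContraction_of_mul_conjTranspose _ U hU
    (fun i => s i * e i * s i) (fun i => ?_) ?_, ?_⟩
  · rcases (hpos i).eq_or_lt with h | h
    · simp [← h]
    · have h2 : √(e i) ≠ 0 := (Real.sqrt_pos.2 h).ne'
      have h3 := Real.mul_self_sqrt h.le
      apply le_of_eq
      simp only [hsdef]
      nth_rewrite 2 [← h3]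
      field_simp
  · calc U * D * Uᴴ * Aᴴ * (U * D * Uᴴ * Aᴴ)ᴴ = U * D * Uᴴ * (Aᴴ * A) * (U * D * Uᴴ) := by
          simp only [Matrix.conjTranspose_mul, Matrix.conjTranspose_conjTranspose, hDH,
            Matrix.mul_assoc]
      _ = U * D * (Uᴴ * U) * Matrix.diagonal (fun i => (e i : ℂ)) * (Uᴴ * U) * D *
            Uᴴ := by rw [hs]; simp only [Matrix.mul_assoc]
      _ = U * (D * Matrix.diagonal (fun i => (e i : ℂ)) * D) * Uᴴ := by
          rw [hU']; simp only [Matrix.mul_assoc, Matrix.one_mul]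
      _ = _ := by
          rw [hD, Matrix.diagonal_mul_diagonal, Matrix.diagonal_mul_diagonal]
          congr 3; ext i; push_cast; rfl
  · calc (U * D * Uᴴ * Aᴴ * A).trace = (U * D * Uᴴ * (Aᴴ * A)).trace := by
          rw [Matrix.mul_assoc _ Aᴴ]
      _ = (U * (D * (Uᴴ * U) * Matrix.diagonal (fun i => (e i : ℂ)) * Uᴴ)).trace := by
          rw [hs]; simp only [Matrix.mul_assoc]
      _ = (D * Matrix.diagonal (fun i => (e i : ℂ))).trace := by
          rw [hU', Matrix.trace_mul_comm]
          simp only [Matrix.mul_assoc, hU', Matrix.mul_one]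
      _ = _ := by
          rw [hD, Matrix.diagonal_mul_diagonal, Matrix.trace_diagonal, htn]
          push_cast
          refine Finset.sum_congr rfl fun i _ => ?_
          have h3 := Real.mul_self_sqrt (hpos i)
          rw [← Complex.ofReal_mul]
          congr 1
          simp only [hsdef]
          by_cases h2 : √(e i) = 0
          · rw [h2]; simp
          · nth_rewrite 2 [← h3]
            field_simp

/-! ### Diamond-norm bound for measure-and-prepare sums -/

/-- A set of pairs is a partial matching if each index is in at most one pair as a left end and in
at most one pair as a right end. -/
def IsPartialMatching {ι : Type*} (P : ι → ι → Prop) : Prop :=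
  (∀ a b b', P a b → P a b' → b = b') ∧ ∀ a a' b, P a b → P a' b → a = a'

theorem IsContraction.block {ι κ : Type*} [Fintype ι] [Fintype κ] [DecidableEq ι]
    {B : Matrix (ι × κ) (ι × κ) ℂ} (hB : IsContraction B) (x y : ι) :
    IsContraction (Matrix.of fun s t => B (x, s) (y, t)) := by
  intro u v
  have h := hB (fun p => if p.1 = x then u p.2 else 0) (fun q => if q.1 = y then v q.2 else 0)
  have e : ∀ (x : ι) (w : κ → ℂ), ∑ p : ι × κ, ‖if p.1 = x then w p.2 else 0‖ ^ 2 =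
      ∑ s, ‖w s‖ ^ 2 := by
    intro x w
    rw [Fintype.sum_prod_type, Finset.sum_eq_single x]
    · simp
    · intro z _ hz; simp [hz]
    · simp
  rw [e, e] at h
  refine le_trans (le_of_eq ?_) h
  congr 1
  rw [Fintype.sum_prod_type, Finset.sum_eq_single x]
  · refine Finset.sum_congr rfl fun s _ => ?_
    rw [Fintype.sum_prod_type, Finset.sum_eq_single y]
    · simp
    · intro z _ hz; simp [hz]
    · simp
  · intro z _ hz; simp [hz]
  · simp

/-- The average of finitely many contractions; for an empty family the factor is `0⁻¹ = 0`. -/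
theorem IsContraction.average {ι κ α : Type*} [Fintype ι] [Fintype κ] (s : Finset α)
    (B : α → Matrix ι κ ℂ) (hB : ∀ i ∈ s, IsContraction (B i)) :
    IsContraction ((s.card : ℂ)⁻¹ • ∑ i ∈ s, B i) := by
  intro u v
  have h1 : ∑ p, ∑ q, star (u p) * ((s.card : ℂ)⁻¹ • ∑ i ∈ s, B i) p q * v q =
      (s.card : ℂ)⁻¹ * ∑ i ∈ s, ∑ p, ∑ q, star (u p) * B i p q * v q := by
    rw [Finset.sum_comm (s := s), Finset.mul_sum]
    refine Finset.sum_congr rfl fun p _ => ?_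
    rw [Finset.sum_comm (s := s), Finset.mul_sum]
    refine Finset.sum_congr rfl fun q _ => ?_
    rw [Matrix.smul_apply, Matrix.sum_apply, smul_eq_mul, Finset.mul_sum, Finset.mul_sum,
      Finset.sum_mul, Finset.mul_sum]
    exact Finset.sum_congr rfl fun i _ => by ring
  rw [h1, norm_mul, norm_inv, Complex.norm_natCast]
  have h2 := norm_sum_le_of_le (f := fun i => ∑ p, ∑ q, star (u p) * B i p q * v q) s
    fun i hi => hB i hi u v
  rw [Finset.sum_const, nsmul_eq_mul] at h2
  refine (mul_le_mul_of_nonneg_left h2 (by positivity)).trans ?_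
  rw [← mul_assoc]
  exact mul_le_of_le_one_left (by positivity) inv_mul_le_one

open Classical in
theorem IsContraction.matching {ι κ : Type*} [Fintype ι] [Fintype κ]
    {P : ι → ι → Prop} (hP : IsPartialMatching P) {T : Matrix κ κ ℂ} (hT : IsContraction T) :
    IsContraction (Matrix.of fun (p q : ι × κ) => if P p.1 q.1 then T p.2 q.2 else 0) := by
  intro u v
  set f : ι → ℝ := fun x => √(∑ s, ‖u (x, s)‖ ^ 2)
  set g : ι → ℝ := fun x => √(∑ s, ‖v (x, s)‖ ^ 2)
  have hf : ∀ x, f x ^ 2 = ∑ s, ‖u (x, s)‖ ^ 2 := fun x => Real.sq_sqrt (by positivity)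
  have hg : ∀ x, g x ^ 2 = ∑ s, ‖v (x, s)‖ ^ 2 := fun x => Real.sq_sqrt (by positivity)
  set S : Finset (ι × ι) := Finset.univ.filter fun z => P z.1 z.2
  have h1 : ∑ p : ι × κ, ∑ q : ι × κ, star (u p) *
      (Matrix.of fun (p q : ι × κ) => if P p.1 q.1 then T p.2 q.2 else 0) p q * v q =
      ∑ z ∈ S, ∑ s, ∑ t, star (u (z.1, s)) * T s t * v (z.2, t) := by
    rw [Finset.sum_filter, Fintype.sum_prod_type, Fintype.sum_prod_type]
    refine Finset.sum_congr rfl fun x _ => ?_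
    simp only [Fintype.sum_prod_type]
    rw [Finset.sum_comm]
    refine Finset.sum_congr rfl fun y _ => ?_
    by_cases h : P x y <;> simp [h]
  rw [h1]
  calc _ ≤ ∑ z ∈ S, f z.1 * g z.2 := norm_sum_le_of_le _ fun z _ => hT _ _
    _ ≤ √(∑ z ∈ S, f z.1 ^ 2) * √(∑ z ∈ S, g z.2 ^ 2) :=
        Real.sum_mul_le_sqrt_mul_sqrt _ _ _
    _ ≤ _ := by
        gcongr
        · have : ∑ z ∈ S, f z.1 ^ 2 = ∑ x ∈ S.image Prod.fst, f x ^ 2 := by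
            rw [Finset.sum_image]
            rintro ⟨a, b⟩ h ⟨a', b'⟩ h' (rfl : a = a')
            simp only [S, Finset.coe_filter, Finset.mem_univ, true_and, Set.mem_ofPred_eq] at h h'
            rw [hP.1 a b b' h h']
          rw [this, Fintype.sum_prod_type]
          simp only [← hf]
          exact Finset.sum_le_univ_sum_of_nonneg fun _ => by positivity
        · have : ∑ z ∈ S, g z.2 ^ 2 = ∑ x ∈ S.image Prod.snd, g x ^ 2 := by
            rw [Finset.sum_image]
            rintro ⟨a, b⟩ h ⟨a', b'⟩ h' (rfl : b = b')
            simp only [S, Finset.coe_filter, Finset.mem_univ, true_and, Set.mem_ofPred_eq] at h h'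
            rw [hP.2 a a' b h h']
          rw [this, Fintype.sum_prod_type]
          simp only [← hg]
          exact Finset.sum_le_univ_sum_of_nonneg fun _ => by positivity

theorem IsPartialMatching.swap {ι : Type*} {P : ι → ι → Prop} (hP : IsPartialMatching P) :
    IsPartialMatching fun b a => P a b :=
  ⟨fun b a a' h h' => hP.2 a a' b h h', fun b b' a h h' => hP.1 a b b' h h'⟩

open Classical in
/-- The functional `X ↦ tr (O_Pᵀ X)`, where `O_P` is the `0`-`1` matrix of the relation `P`. -/
def pairing {ι : Type*} [Fintype ι] (P : ι → ι → Prop) (X : Matrix ι ι ℂ) : ℂ :=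
  ∑ z : ι × ι with P z.1 z.2, X z.1 z.2

open Classical in
/-- A sum of maps `X ↦ g |Q|⁻¹ tr (O_Pᵀ X) O_Q` with `P` a partial matching has diamond norm at
most `∑ |g|`: dually, each summand turns a contraction `B` on the output into the operator
`O_P ⊗ B'`, where `B'` is the average of the blocks of `B` over `Q`. -/
theorem diamondNorm_le_sum {ι α : Type*} [Fintype ι] [DecidableEq ι] [Fintype α]
    (Φ : Matrix ι ι ℂ →ₗ[ℂ] Matrix ι ι ℂ) (g : α → ℂ) (P Q : α → ι → ι → Prop)
    (hP : ∀ i, IsPartialMatching (P i))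
    (hΦ : ∀ X x y, Φ X x y = ∑ i, g i *
      ((Finset.univ.filter fun z : ι × ι => Q i z.1 z.2).card : ℂ)⁻¹ * pairing (P i) X *
        if Q i x y then 1 else 0) :
    diamondNorm Φ ≤ ENNReal.ofReal (∑ i, ‖g i‖) := by
  refine iSup_le fun d => iSup_le fun X => iSup_le fun _ => ENNReal.ofReal_le_ofReal ?_
  refine div_le_of_le_mul₀ (traceNorm_nonneg _) (by positivity) ?_
  obtain ⟨B, hB, hBt⟩ := exists_isContraction_trace_mul_eq (tensorAncilla Φ d X)
  set S : α → Finset (ι × ι) := fun i => Finset.univ.filter fun z : ι × ι => Q i z.1 z.2 with hS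
  set T : α → Matrix (Fin d) (Fin d) ℂ := fun i =>
    ((S i).card : ℂ)⁻¹ • ∑ z ∈ S i, Matrix.of fun t s => B (z.2, t) (z.1, s) with hT
  set C : α → Matrix (ι × Fin d) (ι × Fin d) ℂ := fun i =>
    Matrix.of fun p q => if P i q.1 p.1 then T i p.2 q.2 else 0 with hC
  have hCc : ∀ i, IsContraction (C i) := fun i =>
    IsContraction.matching (hP i).swap (IsContraction.average _ _ fun z _ => hB.block z.2 z.1)
  have key : (B * tensorAncilla Φ d X).trace = ∑ i, g i * (C i * X).trace := by
    have hX : ∀ i, (C i * X).trace = ((S i).card : ℂ)⁻¹ * ∑ t, ∑ s,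
        (∑ z ∈ S i, B (z.2, t) (z.1, s)) *
          pairing (P i) (Matrix.of fun a b => X (a, s) (b, t)) := by
      intro i
      have : (C i * X).trace = ∑ z : ι × ι with P i z.1 z.2, ∑ t, ∑ s,
          T i t s * X (z.1, s) (z.2, t) := by
        rw [Finset.sum_filter, Fintype.sum_prod_type, Finset.sum_comm, Matrix.trace,
          Fintype.sum_prod_type]
        refine Finset.sum_congr rfl fun b _ => ?_
        simp only [Matrix.diag_apply, Matrix.mul_apply, Fintype.sum_prod_type]
        rw [Finset.sum_comm]
        refine Finset.sum_congr rfl fun a _ => ?_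
        by_cases h : P i a b <;> simp [hC, h]
      rw [this, Finset.sum_comm, Finset.mul_sum]
      refine Finset.sum_congr rfl fun t _ => ?_
      rw [Finset.sum_comm, Finset.mul_sum]
      refine Finset.sum_congr rfl fun s _ => ?_
      rw [← Finset.mul_sum, ← mul_assoc]
      congr 1
      simp [hT, Matrix.sum_apply]
    have hY : (B * tensorAncilla Φ d X).trace = ∑ z : ι × ι, ∑ t, ∑ s, B (z.2, t) (z.1, s) *
        Φ (Matrix.of fun a b => X (a, s) (b, t)) z.1 z.2 := by
      rw [Fintype.sum_prod_type, Finset.sum_comm, Matrix.trace, Fintype.sum_prod_type]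
      refine Finset.sum_congr rfl fun y _ => ?_
      simp only [Matrix.diag_apply, Matrix.mul_apply, Fintype.sum_prod_type]
      rw [Finset.sum_comm]
      rfl
    rw [hY]
    simp only [hX, hΦ, Finset.mul_sum]
    have e1 : ∀ (i : α) (t s : Fin d), g i * (((S i).card : ℂ)⁻¹ *
        ((∑ z ∈ S i, B (z.2, t) (z.1, s)) *
          pairing (P i) (Matrix.of fun a b => X (a, s) (b, t)))) =
        ∑ z : ι × ι, B (z.2, t) (z.1, s) * (g i * ((S i).card : ℂ)⁻¹ *
          pairing (P i) (Matrix.of fun a b => X (a, s) (b, t)) *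
            if Q i z.1 z.2 then 1 else 0) := by
      intro i t s
      rw [hS, Finset.sum_filter, Finset.sum_mul, Finset.mul_sum, Finset.mul_sum]
      refine Finset.sum_congr rfl fun z _ => ?_
      by_cases h : Q i z.1 z.2
      · simp only [h, if_true]; ring
      · simp [h]
    simp only [e1]
    rw [Finset.sum_congr rfl fun z _ =>
      (Finset.sum_congr rfl fun t _ => Finset.sum_comm).trans Finset.sum_comm, Finset.sum_comm]
    refine Finset.sum_congr rfl fun i _ => ?_
    rw [Finset.sum_comm]
    exact Finset.sum_congr rfl fun t _ => Finset.sum_comm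
  rw [hBt] at key
  have h := congrArg norm key
  rw [Complex.norm_real, Real.norm_of_nonneg (traceNorm_nonneg _)] at h
  rw [h, Finset.sum_mul]
  refine norm_sum_le_of_le _ fun i _ => ?_
  rw [norm_mul]
  exact mul_le_mul_of_nonneg_left (norm_trace_mul_le_traceNorm _ _ (hCc i)) (norm_nonneg _)

/-! ### Words in random permutations -/

/-- The law of `m` independent uniformly random permutations of `N` points. -/
def permLaw (m N : ℕ) : Measure (Fin m → Equiv.Perm (Fin N)) :=
  Measure.pi fun _ => uniformOn Set.univ

instance permLaw_isProbabilityMeasure (m N : ℕ) : IsProbabilityMeasure (permLaw m N) := by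
  unfold permLaw; infer_instance

theorem measurePreserving_uniformOn_univ {α : Type*} [Fintype α] [MeasurableSpace α]
    [DiscreteMeasurableSpace α] (e : α ≃ α) :
    MeasurePreserving e (uniformOn (Set.univ : Set α)) (uniformOn Set.univ) := by
  refine ⟨measurable_of_finite _, Measure.ext fun s hs => ?_⟩
  rw [Measure.map_apply (measurable_of_finite _) hs, uniformOn_univ, uniformOn_univ,
    ← e.image_symm_eq_preimage, Measure.count_injective_image e.symm.injective]

theorem permLaw_real_le_of_mapsTo {m N : ℕ} (T : Fin m → Equiv.Perm (Equiv.Perm (Fin N)))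
    {A B : Set (Fin m → Equiv.Perm (Fin N))} (h : ∀ σ ∈ A, (fun g => T g (σ g)) ∈ B) :
    (permLaw m N).real A ≤ (permLaw m N).real B := by
  have hT : MeasurePreserving (fun (σ : Fin m → Equiv.Perm (Fin N)) g => T g (σ g))
      (permLaw m N) (permLaw m N) :=
    measurePreserving_pi _ _ fun g => measurePreserving_uniformOn_univ (T g)
  rw [← hT.measureReal_preimage (MeasurableSet.of_discrete (s := B)).nullMeasurableSet]
  exact measureReal_mono h

/-- The permutation of a letter: `(g, true)` stands for `σ_g` and `(g, false)` for `σ_g⁻¹`. -/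
def letterPerm {m N : ℕ} (σ : Fin m → Equiv.Perm (Fin N)) (s : Fin m × Bool) :
    Equiv.Perm (Fin N) :=
  bif s.2 then σ s.1 else (σ s.1)⁻¹

/-- The event that `σ_g a = b` for each triple `(g, a, b)` in `C`. -/
def constraintEvent {m N : ℕ} (C : Set (Fin m × Fin N × Fin N)) :
    Set (Fin m → Equiv.Perm (Fin N)) :=
  {σ | ∀ c ∈ C, σ c.1 c.2.1 = c.2.2}

/-- The triple that expresses that the letter `s` sends `y` to `p`. -/
def letterConstraint {m N : ℕ} (s : Fin m × Bool) (p y : Fin N) : Fin m × Fin N × Fin N :=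
  bif s.2 then (s.1, y, p) else (s.1, p, y)

theorem mem_constraintEvent_insert {m N : ℕ} {C : Set (Fin m × Fin N × Fin N)}
    {s : Fin m × Bool} {p y : Fin N} {σ : Fin m → Equiv.Perm (Fin N)} :
    σ ∈ constraintEvent (insert (letterConstraint s p y) C) ↔
      letterPerm σ s y = p ∧ σ ∈ constraintEvent C := by
  rcases s with ⟨g, _ | _⟩
  · simp only [constraintEvent, letterConstraint, letterPerm, cond_false, Set.mem_ofPred_eq,
      Set.forall_mem_insert, Equiv.Perm.inv_eq_iff_eq, eq_comm (a := y)]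
  · simp [constraintEvent, letterConstraint, letterPerm]

/-- A constraint that brings in a new point `y` costs at most a factor `N`: composing `σ_g` with
the transposition of `y` and `y'` maps the event that the letter `s` sends `y'` to `p` to the event
that it sends `y` to `p`, and it keeps the earlier constraints. -/
theorem permLaw_constraintEvent_le {m N : ℕ} {C : Set (Fin m × Fin N × Fin N)} {F : Finset (Fin N)}
    (hCF : ∀ c ∈ C, c.2.1 ∈ F ∧ c.2.2 ∈ F) {s : Fin m × Bool} {p y : Fin N}
    (hs : ∀ z, letterConstraint s p z ∉ C) (hy : y ∉ F) :
    (permLaw m N).real (constraintEvent C) ≤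
      N * (permLaw m N).real (constraintEvent (insert (letterConstraint s p y) C)) := by
  have hcover : constraintEvent C =
      ⋃ y', constraintEvent (insert (letterConstraint s p y') C) := by
    ext σ
    simp only [Set.mem_iUnion, mem_constraintEvent_insert, exists_and_right]
    exact ⟨fun h => ⟨⟨(letterPerm σ s).symm p, by simp⟩, h⟩, fun h => h.2⟩
  have hle : ∀ y', (permLaw m N).real (constraintEvent (insert (letterConstraint s p y') C)) ≤
      (permLaw m N).real (constraintEvent (insert (letterConstraint s p y) C)) := by
    intro y'
    obtain ⟨g, b⟩ := s
    cases b with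
    | true =>
      apply permLaw_real_le_of_mapsTo
        (fun h => if h = g then Equiv.mulRight (Equiv.swap y y') else Equiv.refl _)
      intro σ hσ
      rw [mem_constraintEvent_insert] at hσ ⊢
      obtain ⟨h1, h2⟩ := hσ
      simp only [letterPerm, cond_true] at h1 ⊢
      refine ⟨by simpa using h1, ?_⟩
      rintro ⟨h, a, b⟩ hc
      by_cases hg : h = g
      · subst hg
        have ha : a ≠ y := fun e => hy (e ▸ (hCF _ hc).1)
        have hb : a ≠ y' := by
          rintro rfl
          have := h2 _ hc
          simp only at this
          apply hs a
          rw [← h1, this]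
          exact hc
        simpa [Equiv.swap_apply_of_ne_of_ne ha hb] using h2 _ hc
      · simpa [hg] using h2 _ hc
    | false =>
      apply permLaw_real_le_of_mapsTo
        (fun h => if h = g then Equiv.mulLeft (Equiv.swap y y') else Equiv.refl _)
      intro σ hσ
      rw [mem_constraintEvent_insert] at hσ ⊢
      obtain ⟨h1, h2⟩ := hσ
      simp only [letterPerm, cond_false, Equiv.Perm.inv_eq_iff_eq] at h1 ⊢
      refine ⟨by simp [← h1], ?_⟩
      rintro ⟨h, a, b⟩ hc
      by_cases hg : h = g
      · subst hg
        have h3 := h2 _ hc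
        simp only at h3
        have ha : b ≠ y := fun e => hy (e ▸ (hCF _ hc).2)
        have hb : b ≠ y' := by
          rintro rfl
          apply hs b
          have : a = p := (σ h).injective (h3.trans h1)
          rw [← this]
          exact hc
        simp [h3, Equiv.swap_apply_of_ne_of_ne ha hb]
      · simpa [hg] using h2 _ hc
  calc (permLaw m N).real (constraintEvent C)
      ≤ ∑ y', (permLaw m N).real (constraintEvent (insert (letterConstraint s p y') C)) := by
        rw [hcover]; exact measureReal_iUnion_fintype_le _
    _ ≤ ∑ _y' : Fin N,
          (permLaw m N).real (constraintEvent (insert (letterConstraint s p y) C)) :=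
        Finset.sum_le_sum fun y' _ => hle y'
    _ = _ := by simp

/-- The inductive lower bound for the probability that a reduced word does not send `x` to `p`.
The preimages of `p` under the letters of the word are revealed one by one; `C` holds the revealed
values, and `F` the points seen so far. Only those outcomes are kept in which each step leads to a
new point. Since the word is reduced, the value that the next step asks for has then not yet been
revealed. -/
theorem permLaw_word_ne_ge {m N K : ℕ} (x : Fin N) (L : List (Fin m × Bool))
    (hL : FreeGroup.IsReduced L) :
    ∀ (C : Set (Fin m × Fin N × Fin N)) (F : Finset (Fin N)) (p : Fin N),
      (∀ c ∈ C, c.2.1 ∈ F ∧ c.2.2 ∈ F) → p ∈ F → x ∈ F →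
      (∀ s ∈ L.head?, ∀ z, letterConstraint s p z ∉ C) → (L = [] → x ≠ p) →
      F.card + L.length ≤ K →
      (((N - K : ℕ) : ℝ) / N) ^ L.length * (permLaw m N).real (constraintEvent C) ≤
        (permLaw m N).real
          (constraintEvent C ∩ {σ | (L.map (letterPerm σ)).prod x ≠ p}) := by
  induction L with
  | nil =>
    intro C F p _ _ _ _ hx _
    have : {σ : Fin m → Equiv.Perm (Fin N) | (([] : List (Fin m × Bool)).map
        (letterPerm σ)).prod x ≠ p} = Set.univ := by
      ext σ; simpa using hx rfl
    rw [this]; simp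
  | cons s L ih =>
    intro C F p hCF hp hxF hs _ hK
    have hN : (0 : ℝ) < N := by exact_mod_cast x.pos
    set ν := permLaw m N
    set q : ℝ := ((N - K : ℕ) : ℝ) / N
    have hL' : FreeGroup.IsReduced L := List.IsChain.tail hL
    set A : Fin N → Set (Fin m → Equiv.Perm (Fin N)) := fun y =>
      constraintEvent (insert (letterConstraint s p y) C) ∩
        {σ | (L.map (letterPerm σ)).prod x ≠ y} with hA
    have hstep : ∀ y ∈ Fᶜ, q ^ L.length * (ν.real (constraintEvent C) / N) ≤ ν.real (A y) := by
      intro y hy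
      rw [Finset.mem_compl] at hy
      have hyp : y ≠ p := fun e => hy (e ▸ hp)
      refine le_trans ?_ (ih hL' _ (insert y F) y ?_ ?_ ?_ ?_ ?_ ?_)
      · refine mul_le_mul_of_nonneg_left ?_ (by positivity)
        rw [div_le_iff₀ hN, mul_comm]
        exact permLaw_constraintEvent_le hCF (hs s (by simp)) hy
      · rintro c (rfl | hc)
        · rcases s with ⟨g, _ | _⟩ <;> simp [letterConstraint, hp]
        · exact ⟨Finset.mem_insert_of_mem (hCF c hc).1, Finset.mem_insert_of_mem (hCF c hc).2⟩
      · exact Finset.mem_insert_self _ _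
      · exact Finset.mem_insert_of_mem hxF
      · intro t ht z hz
        have hred : s.1 = t.1 → s.2 = t.2 := by
          cases L with
          | nil => simp at ht
          | cons t' L =>
            simp only [List.head?_cons, Option.mem_def, Option.some.injEq] at ht
            subst ht
            exact (List.isChain_cons_cons.1 hL).1
        rcases hz with hz | hz
        · rcases s with ⟨g, _ | _⟩ <;> rcases t with ⟨g', _ | _⟩ <;>
            simp_all [letterConstraint]
        · apply hy
          rcases t with ⟨g', _ | _⟩
          · exact (hCF _ hz).1
          · exact (hCF _ hz).2
      · rintro - rfl
        exact hy hxF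
      · rw [Finset.card_insert_of_notMem hy]
        simp only [List.length_cons] at hK
        omega
    have hdisj : ((Fᶜ : Finset (Fin N)) : Set (Fin N)).PairwiseDisjoint A := by
      intro y _ y' _ hyy'
      refine Set.disjoint_left.2 fun σ h h' => hyy' ?_
      exact (letterPerm σ s).injective ((mem_constraintEvent_insert.1 h.1).1.trans
        (mem_constraintEvent_insert.1 h'.1).1.symm)
    have hsub : ⋃ y ∈ Fᶜ, A y ⊆
        constraintEvent C ∩ {σ | ((s :: L).map (letterPerm σ)).prod x ≠ p} := by
      intro σ hσ
      simp only [Set.mem_iUnion] at hσ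
      obtain ⟨y, _, h1, h2⟩ := hσ
      obtain ⟨h3, h4⟩ := mem_constraintEvent_insert.1 h1
      refine ⟨h4, fun h => h2 ?_⟩
      simp only [List.map_cons, List.prod_cons, Equiv.Perm.coe_mul, Function.comp] at h
      exact (letterPerm σ s).injective (h.trans h3.symm)
    refine le_trans ?_ (measureReal_mono hsub)
    rw [measureReal_biUnion_finset hdisj fun _ _ => MeasurableSet.of_discrete]
    refine le_trans ?_ (Finset.sum_le_sum hstep)
    rw [Finset.sum_const, nsmul_eq_mul, Finset.card_compl, Fintype.card_fin, List.length_cons,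
      pow_succ]
    have h5 : ((N - K : ℕ) : ℝ) ≤ ((N - F.card : ℕ) : ℝ) := by
      exact_mod_cast Nat.sub_le_sub_left (by omega) N
    calc q ^ L.length * q * ν.real (constraintEvent C)
        = ((N - K : ℕ) : ℝ) * (q ^ L.length * (ν.real (constraintEvent C) / N)) := by
          simp only [q]; ring
      _ ≤ _ := mul_le_mul_of_nonneg_right h5 (by positivity)

/-- A bound for the probability that a nontrivial reduced word of length `n` sends a given point to
a given point; it vanishes for `n = 0`. -/
def wordBound (n N : ℕ) : ℝ := 1 - (((N - (n + 2) : ℕ) : ℝ) / N) ^ n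

theorem tendsto_wordBound (n : ℕ) : Tendsto (wordBound n) atTop (𝓝 0) := by
  have h1 : Tendsto (fun N : ℕ => ((N - (n + 2) : ℕ) : ℝ) / N) atTop (𝓝 1) := by
    have h2 : Tendsto (fun N : ℕ => 1 - ((n + 2 : ℕ) : ℝ) / (N : ℝ)) atTop (𝓝 (1 - 0)) :=
      tendsto_const_nhds.sub (tendsto_const_div_atTop_nhds_zero_nat _)
    rw [sub_zero] at h2
    refine h2.congr' ?_
    filter_upwards [eventually_ge_atTop (n + 2)] with N hN
    have : (N : ℝ) ≠ 0 := by
      have : N ≠ 0 := by omega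
      exact_mod_cast this
    rw [Nat.cast_sub hN]
    field_simp
  have h3 := (tendsto_const_nhds (x := (1 : ℝ))).sub (h1.pow n)
  rw [one_pow, sub_self] at h3
  exact h3

theorem permLaw_word_eq_le {m N : ℕ} {u : FreeGroup (Fin m)} (hu : u ≠ 1) (x p : Fin N) :
    (permLaw m N).real {σ | FreeGroup.lift σ u x = p} ≤ wordBound u.toWord.length N := by
  have hne : u.toWord ≠ [] := by simpa using hu
  have h := permLaw_word_ne_ge (K := u.toWord.length + 2) x u.toWord FreeGroup.isReduced_toWord
    ∅ {x, p} p (by simp) (by simp) (by simp) (by simp) (fun h => absurd h hne) (by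
      have : ({x, p} : Finset (Fin N)).card ≤ 2 := Finset.card_le_two
      omega)
  have h1 : constraintEvent (∅ : Set (Fin m × Fin N × Fin N)) = Set.univ := by
    ext; simp [constraintEvent]
  have h2 : {σ : Fin m → Equiv.Perm (Fin N) | FreeGroup.lift σ u x = p}ᶜ =
      {σ | (u.toWord.map (letterPerm σ)).prod x ≠ p} := by
    ext σ
    have : FreeGroup.lift σ u = (u.toWord.map (letterPerm σ)).prod := by
      conv_lhs => rw [← FreeGroup.mk_toWord (x := u)]
      exact FreeGroup.lift_mk
    simp [this]
  rw [h1, Set.univ_inter, ← h2, probReal_compl_eq_one_sub MeasurableSet.of_discrete,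
    probReal_univ, mul_one] at h
  unfold wordBound
  linarith

/-! ### Monomial matrices and equality patterns -/

/-- `M` has the support of the permutation matrix of `π`, with nonzero entries of modulus one. -/
def IsMonomial {N : ℕ} (π : Equiv.Perm (Fin N)) (M : Matrix (Fin N) (Fin N) ℂ) : Prop :=
  (∀ x a, x ≠ π a → M x a = 0) ∧ ∀ a, ‖M (π a) a‖ = 1

theorem IsMonomial.one {N : ℕ} : IsMonomial (1 : Equiv.Perm (Fin N)) 1 :=
  ⟨fun _ _ h => Matrix.one_apply_ne h,
    fun a => by rw [Equiv.Perm.one_apply, Matrix.one_apply_eq, norm_one]⟩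

theorem IsMonomial.mul {N : ℕ} {π ρ : Equiv.Perm (Fin N)} {A B : Matrix (Fin N) (Fin N) ℂ}
    (hA : IsMonomial π A) (hB : IsMonomial ρ B) : IsMonomial (π * ρ) (A * B) := by
  have h : ∀ x a, (A * B) x a = A x (ρ a) * B (ρ a) a := by
    intro x a
    rw [Matrix.mul_apply, Finset.sum_eq_single (ρ a)]
    · intro y _ hy
      rw [hB.1 y a hy, mul_zero]
    · simp
  refine ⟨fun x a hx => ?_, fun a => ?_⟩
  · rw [h, hA.1 x _ hx, zero_mul]
  · rw [h, norm_mul, Equiv.Perm.mul_apply, hA.2, hB.2, one_mul]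

theorem IsMonomial.conjTranspose {N : ℕ} {π : Equiv.Perm (Fin N)}
    {A : Matrix (Fin N) (Fin N) ℂ} (hA : IsMonomial π A) : IsMonomial π⁻¹ Aᴴ := by
  refine ⟨fun x a hx => ?_, fun a => ?_⟩
  · rw [Matrix.conjTranspose_apply, hA.1 a x, star_zero]
    rintro rfl
    simp at hx
  · have := hA.2 (π⁻¹ a)
    rw [Matrix.conjTranspose_apply, norm_star]
    simpa using this

theorem isMonomial_toMatrix {N : ℕ} (p : PhasedPerm N) : IsMonomial p.1 p.toMatrix := by
  refine ⟨fun x a hx => ?_, fun a => ?_⟩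
  · rw [PhasedPerm.toMatrix_apply, if_neg hx]
  · rw [PhasedPerm.toMatrix_apply, if_pos rfl, Circle.norm_coe]

theorem IsMonomial.norm_apply_le {N : ℕ} {π : Equiv.Perm (Fin N)}
    {A : Matrix (Fin N) (Fin N) ℂ} (hA : IsMonomial π A) (x a : Fin N) : ‖A x a‖ ≤ 1 := by
  by_cases h : x = π a
  · rw [h, hA.2]
  · rw [hA.1 x a h, norm_zero]; exact zero_le_one

theorem coe_toUnitary {N : ℕ} (p : PhasedPerm N) :
    (p.toUnitary : Matrix (Fin N) (Fin N) ℂ) = p.toMatrix := rfl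

theorem IsMonomial.word {m N : ℕ} (Z : Fin m → PhasedPerm N) (u : FreeGroup (Fin m)) :
    IsMonomial (FreeGroup.lift (fun g => (Z g).1) u)
      (FreeGroup.lift (fun g => PhasedPerm.toUnitary (Z g)) u : Matrix.unitaryGroup (Fin N) ℂ) := by
  induction u using FreeGroup.induction_on with
  | C1 => simpa using IsMonomial.one
  | of g => simpa [coe_toUnitary] using isMonomial_toMatrix (Z g)
  | inv_of g _ => simpa [coe_toUnitary, Matrix.star_eq_conjTranspose] using (isMonomial_toMatrix (Z g)).conjTranspose
  | mul u v hu hv => simpa using hu.mul hv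

theorem measurable_toMatrix_apply {N : ℕ} (x a : Fin N) :
    Measurable fun p : PhasedPerm N => p.toMatrix x a := by
  simp only [PhasedPerm.toMatrix_apply]
  refine Measurable.ite ?_ ?_ measurable_const
  · exact measurable_fst (MeasurableSet.of_discrete (s := {σ : Equiv.Perm (Fin N) | x = σ a}))
  · have hc : Continuous fun z : Circle => (z : ℂ) := continuous_subtype_val
    exact hc.measurable.comp ((measurable_pi_apply x).comp measurable_snd)

theorem measurable_word_apply {m N : ℕ} (u : FreeGroup (Fin m)) : ∀ x a : Fin N,
    Measurable fun Z : Fin m → PhasedPerm N =>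
      (FreeGroup.lift (fun g => PhasedPerm.toUnitary (Z g)) u :
        Matrix.unitaryGroup (Fin N) ℂ).1 x a := by
  have hof : ∀ (g : Fin m) (x a : Fin N),
      Measurable fun Z : Fin m → PhasedPerm N => (Z g).toMatrix x a :=
    fun g x a => (measurable_toMatrix_apply x a).comp (measurable_pi_apply g)
  induction u using FreeGroup.induction_on with
  | C1 => intro x a; simp
  | of g => intro x a; simpa [coe_toUnitary] using hof g x a
  | inv_of g _ =>
    intro x a
    have : Measurable fun Z : Fin m → PhasedPerm N => star ((Z g).toMatrix a x) :=
      continuous_star.measurable.comp (hof g a x)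
    simpa [coe_toUnitary] using this
  | mul u v hu hv =>
    intro x a
    simp only [map_mul, Submonoid.coe_mul, Matrix.mul_apply]
    exact Finset.measurable_fun_sum _ fun y _ => (hu x y).mul (hv y a)

/-- The equality pattern of the points `x_1, …, x_k, y_1, …, y_k`. -/
def pattern {k : ℕ} {α : Type*} (x y : Fin k → α) : Fin k ⊕ Fin k → Fin k ⊕ Fin k → Prop :=
  fun p q => Sum.elim x y p = Sum.elim x y q

/-- A pattern is balanced if it makes `y` a rearrangement of `x`. -/
def IsBalanced {k : ℕ} (c : Fin k ⊕ Fin k → Fin k ⊕ Fin k → Prop) : Prop :=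
  ∃ e : Equiv.Perm (Fin k), ∀ i, c (Sum.inl i) (Sum.inr (e i))

theorem isBalanced_pattern {k : ℕ} {α : Type*} {x y : Fin k → α} :
    IsBalanced (pattern x y) ↔ ∃ e : Equiv.Perm (Fin k), ∀ i, x i = y (e i) :=
  Iff.rfl

theorem isPartialMatching_of_isBalanced {k : ℕ} {α : Type*}
    {c : Fin k ⊕ Fin k → Fin k ⊕ Fin k → Prop} (hc : IsBalanced c) :
    IsPartialMatching fun x y : Fin k → α => pattern x y = c := by
  obtain ⟨e, he⟩ := hc
  have h : ∀ x y : Fin k → α, pattern x y = c → ∀ i, x i = y (e i) := by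
    rintro x y rfl; exact he
  refine ⟨fun a b b' hb hb' => funext fun i => ?_, fun a a' b ha ha' => funext fun i => ?_⟩
  · have h1 := h _ _ hb (e.symm i)
    have h2 := h _ _ hb' (e.symm i)
    rw [Equiv.apply_symm_apply] at h1 h2
    rw [← h1, ← h2]
  · rw [h _ _ ha, h _ _ ha']

/-- For unimodular factors the two products of a balanced pattern cancel. -/
theorem prod_mul_star_prod_of_isBalanced {k : ℕ} {α : Type*} {x y : Fin k → α}
    (h : IsBalanced (pattern x y)) (f : α → ℂ) (hf : ∀ i, ‖f (x i)‖ = 1) :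
    (∏ i, f (x i)) * star (∏ i, f (y i)) = 1 := by
  obtain ⟨e, he⟩ := isBalanced_pattern.1 h
  have : ∏ i, f (y i) = ∏ i, f (x i) := by
    rw [← Equiv.prod_comp e fun i => f (y i)]
    simp only [he]
  rw [this]
  change _ * (starRingEnd ℂ) _ = 1
  rw [Complex.mul_conj', norm_prod]
  simp [hf]

open Classical in
/-- The sum of the coefficients of `V_{s_1} ⊗ ⋯ ⊗ V_{s_k} |a⟩⟨b| V_{t_1}ᴴ ⊗ ⋯ ⊗ V_{t_k}ᴴ` at the
pairs with pattern `c`. -/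
def classSum {k ℓ N : ℕ} (V : Fin ℓ → Matrix (Fin N) (Fin N) ℂ) (s t : Fin k → Fin ℓ)
    (a b : Fin k → Fin N) (c : Fin k ⊕ Fin k → Fin k ⊕ Fin k → Prop) : ℂ :=
  ∑ z : (Fin k → Fin N) × (Fin k → Fin N) with pattern z.1 z.2 = c,
    tensor (fun i => V (s i)) z.1 a * star (tensor (fun i => V (t i)) z.2 b)

open Classical in
theorem classSum_eq {k ℓ N : ℕ} {V : Fin ℓ → Matrix (Fin N) (Fin N) ℂ}
    {π : Fin ℓ → Equiv.Perm (Fin N)} (hV : ∀ i, IsMonomial (π i) (V i)) (s t : Fin k → Fin ℓ)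
    (a b : Fin k → Fin N) (c : Fin k ⊕ Fin k → Fin k ⊕ Fin k → Prop) :
    classSum V s t a b c =
      if pattern (fun i => π (s i) (a i)) (fun i => π (t i) (b i)) = c then
        (∏ i, V (s i) (π (s i) (a i)) (a i)) * star (∏ i, V (t i) (π (t i) (b i)) (b i))
      else 0 := by
  rw [classSum, Finset.sum_filter,
    Finset.sum_eq_single (fun i => π (s i) (a i), fun i => π (t i) (b i))]
  · rfl
  · rintro ⟨x, y⟩ _ hxy
    have : tensor (fun i => V (s i)) x a * star (tensor (fun i => V (t i)) y b) = 0 := by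
      simp only [tensor, Matrix.of_apply]
      by_cases hx : x = fun i => π (s i) (a i)
      · have hy : y ≠ fun i => π (t i) (b i) := fun hy => hxy (by rw [hx, hy])
        obtain ⟨i, hi⟩ := Function.ne_iff.1 hy
        rw [Finset.prod_eq_zero (f := fun i => V (t i) (y i) (b i)) (Finset.mem_univ i)
          ((hV _).1 _ _ hi), star_zero, mul_zero]
      · obtain ⟨i, hi⟩ := Function.ne_iff.1 hx
        rw [Finset.prod_eq_zero (f := fun i => V (s i) (x i) (a i)) (Finset.mem_univ i)
          ((hV _).1 _ _ hi), zero_mul]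
    simp only [this, ite_self]
  · simp

theorem norm_classSum_le {k ℓ N : ℕ} {V : Fin ℓ → Matrix (Fin N) (Fin N) ℂ}
    {π : Fin ℓ → Equiv.Perm (Fin N)} (hV : ∀ i, IsMonomial (π i) (V i)) (s t : Fin k → Fin ℓ)
    (a b : Fin k → Fin N) (c : Fin k ⊕ Fin k → Fin k ⊕ Fin k → Prop) :
    ‖classSum V s t a b c‖ ≤ 1 := by
  classical
  rw [classSum_eq hV]
  split_ifs
  · simp [norm_prod, (hV _).2]
  · simp

open Classical in
/-- If the endpoints `π_{s_i} a_i`, `π_{t_i} b_i` have no coincidences other than those between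
equal pairs of index and starting point, the class sum is determined by the pattern of these pairs:
on a balanced class all phases cancel. -/
theorem classSum_eq_of_generic {k ℓ N : ℕ} {V : Fin ℓ → Matrix (Fin N) (Fin N) ℂ}
    {π : Fin ℓ → Equiv.Perm (Fin N)} (hV : ∀ i, IsMonomial (π i) (V i)) (s t : Fin k → Fin ℓ)
    (a b : Fin k → Fin N) {c : Fin k ⊕ Fin k → Fin k ⊕ Fin k → Prop} (hc : IsBalanced c)
    (h : pattern (fun i => π (s i) (a i)) (fun i => π (t i) (b i)) =
      pattern (fun i => (s i, a i)) (fun i => (t i, b i))) :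
    classSum V s t a b c =
      if pattern (fun i => (s i, a i)) (fun i => (t i, b i)) = c then 1 else 0 := by
  rw [classSum_eq hV, h]
  split_ifs with h1
  · exact prod_mul_star_prod_of_isBalanced (h1 ▸ hc) (fun z => V z.1 (π z.1 z.2) z.2)
      fun i => (hV _).2 _
  · rfl

/-! ### Mixed moments of words -/

theorem measurePreserving_perms (m N : ℕ) :
    MeasurePreserving (fun (Z : Fin m → PhasedPerm N) g => (Z g).1) (iidLaw m N)
      (permLaw m N) :=
  measurePreserving_pi _ _ fun _ => measurePreserving_fst

instance iidLaw_isProbabilityMeasure (m N : ℕ) : IsProbabilityMeasure (iidLaw m N) := by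
  unfold iidLaw; infer_instance

theorem wordBound_nonneg (n N : ℕ) : 0 ≤ wordBound n N := by
  refine sub_nonneg.2 (pow_le_one₀ (by positivity) (div_le_one_of_le₀ ?_ (by positivity)))
  exact_mod_cast Nat.sub_le _ _

/-- A union bound for the coincidences between the endpoints of the words `w_{J p}`. The trivial
words `w_{J p}⁻¹ w_{J p}` contribute `0`. -/
def coincidenceBound {m ℓ k : ℕ} (w : Fin ℓ → FreeGroup (Fin m)) (s t : Fin k → Fin ℓ)
    (N : ℕ) : ℝ :=
  ∑ p, ∑ q, wordBound ((w (Sum.elim s t q))⁻¹ * w (Sum.elim s t p)).toWord.length N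

theorem tendsto_coincidenceBound {m ℓ k : ℕ} (w : Fin ℓ → FreeGroup (Fin m))
    (s t : Fin k → Fin ℓ) : Tendsto (coincidenceBound w s t) atTop (𝓝 0) := by
  have : Tendsto (fun N => coincidenceBound w s t N) atTop
      (𝓝 (∑ _p : Fin k ⊕ Fin k, ∑ _q : Fin k ⊕ Fin k, (0 : ℝ))) :=
    tendsto_finsetSum _ fun p _ => tendsto_finsetSum _ fun q _ => tendsto_wordBound _
  simpa using this

theorem permLaw_coincidence_le {m ℓ k N : ℕ} {w : Fin ℓ → FreeGroup (Fin m)}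
    (hw : Function.Injective w) (s t : Fin k → Fin ℓ) (a b : Fin k → Fin N) :
    (permLaw m N).real {σ |
      pattern (fun i => FreeGroup.lift σ (w (s i)) (a i))
        (fun i => FreeGroup.lift σ (w (t i)) (b i)) ≠
      pattern (fun i => (s i, a i)) (fun i => (t i, b i))} ≤ coincidenceBound w s t N := by
  set J := Sum.elim s t
  set A := Sum.elim a b
  have e1 : ∀ σ : Fin m → Equiv.Perm (Fin N), Sum.elim (fun i => FreeGroup.lift σ (w (s i)) (a i))
      (fun i => FreeGroup.lift σ (w (t i)) (b i)) = fun p => FreeGroup.lift σ (w (J p)) (A p) := by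
    intro σ; ext (i | i) <;> rfl
  have e2 : Sum.elim (fun i => (s i, a i)) (fun i => (t i, b i)) = fun p => (J p, A p) := by
    ext1 (i | i) <;> rfl
  set E : Fin k ⊕ Fin k → Fin k ⊕ Fin k → Set (Fin m → Equiv.Perm (Fin N)) := fun p q =>
    {σ | FreeGroup.lift σ (w (J p)) (A p) = FreeGroup.lift σ (w (J q)) (A q) ∧
      (J p, A p) ≠ (J q, A q)} with hE
  have hE' : ∀ p q, (permLaw m N).real (E p q) ≤
      wordBound ((w (J q))⁻¹ * w (J p)).toWord.length N := by
    intro p q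
    by_cases h : J p = J q
    · have : E p q = ∅ := by
        ext σ
        simp only [hE, Set.mem_ofPred_eq, Set.mem_empty_iff_false, iff_false, not_and, not_not]
        intro h1
        rw [h] at h1
        rw [h, (FreeGroup.lift σ (w (J q))).injective h1]
      rw [this, measureReal_empty]
      exact wordBound_nonneg _ _
    · have hu : (w (J q))⁻¹ * w (J p) ≠ 1 := fun e => h (hw (inv_mul_eq_one.1 e)).symm
      refine le_trans (measureReal_mono ?_) (permLaw_word_eq_le hu (A p) (A q))
      rintro σ ⟨h1, _⟩
      simp [h1]
  have hsub : {σ : Fin m → Equiv.Perm (Fin N) | pattern (fun i => FreeGroup.lift σ (w (s i)) (a i))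
        (fun i => FreeGroup.lift σ (w (t i)) (b i)) ≠
      pattern (fun i => (s i, a i)) (fun i => (t i, b i))} ⊆ ⋃ p, ⋃ q, E p q := by
    intro σ hσ
    by_contra hcon
    simp only [Set.mem_iUnion, not_exists] at hcon
    apply hσ
    ext p q
    simp only [pattern, e1, e2]
    constructor
    · intro h
      by_contra h'
      exact hcon p q ⟨h, h'⟩
    · intro h
      rw [Prod.mk.injEq] at h
      rw [h.1, h.2]
  refine (measureReal_mono hsub).trans ((measureReal_iUnion_fintype_le _).trans ?_)
  refine Finset.sum_le_sum fun p _ => (measureReal_iUnion_fintype_le _).trans ?_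
  exact Finset.sum_le_sum fun q _ => hE' p q

theorem integrable_tensor_mul_star {m ℓ k N : ℕ} (w : Fin ℓ → FreeGroup (Fin m))
    (s t : Fin k → Fin ℓ) (x a y b : Fin k → Fin N) :
    Integrable (fun Z => tensor (fun i => evalWords w Z (s i)) x a *
      star (tensor (fun i => evalWords w Z (t i)) y b)) (iidLaw m N) := by
  have hm : ∀ (s : Fin k → Fin ℓ) (x a : Fin k → Fin N),
      Measurable fun Z : Fin m → PhasedPerm N => tensor (fun i => evalWords w Z (s i)) x a :=
    fun s x a => Finset.measurable_fun_prod Finset.univ fun i _ =>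
      measurable_word_apply (w (s i)) (x i) (a i)
  have hb : ∀ (s : Fin k → Fin ℓ) (x a : Fin k → Fin N) (Z : Fin m → PhasedPerm N),
      ‖tensor (fun i => evalWords w Z (s i)) x a‖ ≤ 1 := fun s x a Z => by
    simp only [tensor, Matrix.of_apply, norm_prod]
    exact Finset.prod_le_one (fun _ _ => norm_nonneg _)
      fun i _ => (IsMonomial.word Z (w (s i))).norm_apply_le _ _
  refine Integrable.of_bound
    ((hm s x a).mul (continuous_star.measurable.comp (hm t y b))).aestronglyMeasurable 1
    (Eventually.of_forall fun Z => ?_)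
  rw [norm_mul]
  exact mul_le_one₀ (hb s x a Z) (norm_nonneg _) ((norm_star _).trans_le (hb t y b Z))

open Classical in
/-- The mixed moments of distinct words, summed over a balanced class, converge to a limit that
depends neither on the words nor on the number of generators. -/
theorem norm_integral_classSum_sub_le {m ℓ k N : ℕ} {w : Fin ℓ → FreeGroup (Fin m)}
    (hw : Function.Injective w) (s t : Fin k → Fin ℓ) (a b : Fin k → Fin N)
    {c : Fin k ⊕ Fin k → Fin k ⊕ Fin k → Prop} (hc : IsBalanced c) :
    ‖(∫ Z, classSum (evalWords w Z) s t a b c ∂(iidLaw m N)) -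
      (if pattern (fun i => (s i, a i)) (fun i => (t i, b i)) = c then 1 else 0)‖ ≤
      2 * coincidenceBound w s t N := by
  set r : ℂ := if pattern (fun i => (s i, a i)) (fun i => (t i, b i)) = c then 1 else 0 with hr
  have hr1 : ‖r‖ ≤ 1 := by rw [hr]; split_ifs <;> simp
  have hint : Integrable (fun Z => classSum (evalWords w Z) s t a b c) (iidLaw m N) :=
    integrable_finsetSum _ fun z _ => integrable_tensor_mul_star w s t z.1 a z.2 b
  set B : Set (Fin m → Equiv.Perm (Fin N)) := {σ |
      pattern (fun i => FreeGroup.lift σ (w (s i)) (a i))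
        (fun i => FreeGroup.lift σ (w (t i)) (b i)) ≠
      pattern (fun i => (s i, a i)) (fun i => (t i, b i))} with hB
  set B' := (fun (Z : Fin m → PhasedPerm N) g => (Z g).1) ⁻¹' B with hB'
  have hBm : MeasurableSet B' :=
    (measurePreserving_perms m N).measurable (MeasurableSet.of_discrete (s := B))
  have h1 : (∫ Z, classSum (evalWords w Z) s t a b c ∂(iidLaw m N)) - r =
      ∫ Z, (classSum (evalWords w Z) s t a b c - r) ∂(iidLaw m N) := by
    rw [integral_sub hint (integrable_const _), integral_const, probReal_univ, one_smul]
  have h2 : ∀ Z : Fin m → PhasedPerm N,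
      ‖classSum (evalWords w Z) s t a b c - r‖ ≤ B'.indicator (fun _ => (2 : ℝ)) Z := by
    intro Z
    have hV : ∀ i, IsMonomial (FreeGroup.lift (fun g => (Z g).1) (w i)) (evalWords w Z i) :=
      fun i => IsMonomial.word Z (w i)
    by_cases hZ : Z ∈ B'
    · rw [Set.indicator_of_mem hZ]
      have := norm_classSum_le hV s t a b c
      linarith [norm_sub_le (classSum (evalWords w Z) s t a b c) r]
    · rw [Set.indicator_of_notMem hZ]
      rw [classSum_eq_of_generic hV s t a b hc (not_not.1 hZ), hr, sub_self, norm_zero]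
  rw [h1]
  refine (norm_integral_le_of_norm_le ((integrable_const _).indicator hBm)
    (Eventually.of_forall h2)).trans ?_
  rw [integral_indicator_const _ hBm, smul_eq_mul, mul_comm,
    (measurePreserving_perms m N).measureReal_preimage
      (MeasurableSet.of_discrete (s := B)).nullMeasurableSet]
  exact mul_le_mul_of_nonneg_left (permLaw_coincidence_le hw s t a b) zero_le_two

/-! ### The symmetrization -/

open Classical in
theorem tensor_toMatrix_apply {k N : ℕ} (p : PhasedPerm N) (x a : Fin k → Fin N) :
    tensor (fun _ => p.toMatrix) x a =
      if p.1 ∘ a = x then ∏ i, (p.2 (x i) : ℂ) else 0 := by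
  simp only [tensor, Matrix.of_apply, PhasedPerm.toMatrix_apply]
  split_ifs with h
  · subst h; simp
  · obtain ⟨i, hi⟩ := Function.ne_iff.1 h
    exact Finset.prod_eq_zero (Finset.mem_univ i) (if_neg (Ne.symm hi))

theorem measurable_tensor_toMatrix {k N : ℕ} (x a : Fin k → Fin N) :
    Measurable fun p : PhasedPerm N => tensor (fun _ => p.toMatrix) x a :=
  Finset.measurable_fun_prod Finset.univ fun i _ => measurable_toMatrix_apply (x i) (a i)

/-- The kernel `𝔼 Z^{⊗k}_{x a} conj(Z^{⊗k}_{y b})` of the symmetrization. -/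
def symmetrizationKernel {k N : ℕ} (x a y b : Fin k → Fin N) : ℂ :=
  ∫ p, tensor (fun _ => PhasedPerm.toMatrix p) x a *
    star (tensor (fun _ => PhasedPerm.toMatrix p) y b) ∂(phasedPermLaw N)

theorem symmetrization_apply {k N : ℕ} (X : TensorOp k N) (x y : Fin k → Fin N) :
    symmetrization k N X x y = ∑ a, ∑ b, symmetrizationKernel x a y b * X a b :=
  rfl

/-- Rotating all phases by a fixed diagonal unitary `ζ` multiplies the kernel by a phase. -/
theorem symmetrizationKernel_eq_phase_mul {k N : ℕ} (ζ : Fin N → Circle)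
    (x a y b : Fin k → Fin N) : symmetrizationKernel x a y b =
      (∏ i, (ζ (x i) : ℂ)) * star (∏ i, (ζ (y i) : ℂ)) * symmetrizationKernel x a y b := by
  have hT : MeasurePreserving (Prod.map id fun z => ζ * z) (phasedPermLaw N)
      (phasedPermLaw N) :=
    (MeasurePreserving.id _).prod (measurePreserving_mul_left _ ζ)
  have hm : Measurable fun p : PhasedPerm N => tensor (fun _ => p.toMatrix) x a *
      star (tensor (fun _ => p.toMatrix) y b) :=
    (measurable_tensor_toMatrix x a).mul
      (continuous_star.measurable.comp (measurable_tensor_toMatrix y b))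
  have h0 := integral_map (μ := phasedPermLaw N) hT.measurable.aemeasurable
    hm.aestronglyMeasurable
  rw [hT.map_eq] at h0
  rw [symmetrizationKernel, ← integral_const_mul]
  refine h0.trans ?_
  congr 1 with p
  have h : ∀ x a : Fin k → Fin N,
      tensor (fun _ => PhasedPerm.toMatrix (Prod.map id (fun z => ζ * z) p)) x a =
        (∏ i, (ζ (x i) : ℂ)) * tensor (fun _ => PhasedPerm.toMatrix p) x a := by
    intro x a
    simp only [tensor_toMatrix_apply, Prod.map_fst, Prod.map_snd, id, Pi.mul_apply,
      Circle.coe_mul, Finset.prod_mul_distrib, mul_ite, mul_zero]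
  rw [h, h, star_mul']
  ring

/-- The phase average kills the matrix units `|x⟩⟨y|` for which `y` is not a rearrangement of `x`:
if a value `v` occurs `n` times in `x` and `n' ≠ n` times in `y`, a rotation of the `v`-th phase by
a primitive `(k+1)`-st root of unity multiplies the average by a number other than `1`. -/
theorem symmetrizationKernel_eq_zero {k N : ℕ} {x y : Fin k → Fin N}
    (h : ¬ IsBalanced (pattern x y)) (a b : Fin k → Fin N) :
    symmetrizationKernel x a y b = 0 := by
  classical
  by_contra hne
  apply h
  set ω : Circle := Circle.exp (2 * Real.pi / ((k + 1 : ℕ) : ℝ)) with hω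
  have hprim : IsPrimitiveRoot (ω : ℂ) (k + 1) := by
    have h1 := Complex.isPrimitiveRoot_exp (k + 1) k.succ_ne_zero
    have h2 : (ω : ℂ) = Complex.exp (2 * Real.pi * Complex.I / ((k + 1 : ℕ) : ℂ)) := by
      rw [hω, Circle.coe_exp]
      congr 1
      push_cast
      ring
    rwa [h2]
  have hcard : ∀ v, Fintype.card {i // x i = v} = Fintype.card {i // y i = v} := by
    intro v
    have hprod : ∀ x : Fin k → Fin N, ∏ i, ((Pi.mulSingle v ω : Fin N → Circle) (x i) : ℂ) =
        (ω : ℂ) ^ Fintype.card {i // x i = v} := by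
      intro x
      rw [Fintype.card_subtype, ← Finset.prod_const, Finset.prod_filter]
      refine Finset.prod_congr rfl fun i _ => ?_
      by_cases hi : x i = v
      · subst hi; simp
      · simp [hi]
    have h1 := symmetrizationKernel_eq_phase_mul (Pi.mulSingle v ω) x a y b
    rw [hprod, hprod, eq_comm, mul_eq_right₀ hne] at h1
    have hle : ∀ x : Fin k → Fin N, Fintype.card {i // x i = v} < k + 1 := fun x =>
      Nat.lt_succ_of_le ((Fintype.card_subtype_le _).trans_eq (Fintype.card_fin k))
    refine hprim.pow_inj (hle x) (hle y) ?_
    have h2 : star ((ω : ℂ) ^ Fintype.card {i // y i = v}) *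
        (ω : ℂ) ^ Fintype.card {i // y i = v} = 1 := by
      change (starRingEnd ℂ) _ * _ = 1
      rw [Complex.conj_mul', norm_pow, Circle.norm_coe]
      simp
    calc (ω : ℂ) ^ Fintype.card {i // x i = v}
        = (ω : ℂ) ^ Fintype.card {i // x i = v} *
            (star ((ω : ℂ) ^ Fintype.card {i // y i = v}) *
              (ω : ℂ) ^ Fintype.card {i // y i = v}) := by rw [h2, mul_one]
      _ = _ := by rw [← mul_assoc, h1, one_mul]
  let e : Equiv.Perm (Fin k) := Equiv.ofFiberEquiv fun v => Fintype.equivOfCardEq (hcard v)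
  exact isBalanced_pattern.2 ⟨e, fun i => (Equiv.ofFiberEquiv_map _ i).symm⟩

theorem symmetrizationKernel_of_isBalanced {k N : ℕ} {x y : Fin k → Fin N}
    (h : IsBalanced (pattern x y)) (a b : Fin k → Fin N) :
    symmetrizationKernel x a y b =
      ((uniformOn Set.univ).real {σ : Equiv.Perm (Fin N) | σ ∘ a = x ∧ σ ∘ b = y} : ℂ) := by
  classical
  set E := {σ : Equiv.Perm (Fin N) | σ ∘ a = x ∧ σ ∘ b = y} with hE
  have hfst : MeasurePreserving Prod.fst (phasedPermLaw N)
      (uniformOn (Set.univ : Set (Equiv.Perm (Fin N)))) := measurePreserving_fst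
  have h1 : ∀ p : PhasedPerm N, tensor (fun _ => PhasedPerm.toMatrix p) x a *
      star (tensor (fun _ => PhasedPerm.toMatrix p) y b) =
        (Prod.fst ⁻¹' E).indicator (fun _ => (1 : ℂ)) p := by
    intro p
    rw [tensor_toMatrix_apply, tensor_toMatrix_apply, Set.indicator_apply]
    by_cases hx : p.1 ∘ a = x <;> by_cases hy : p.1 ∘ b = y <;> simp only [hx, hy, hE,
      Set.mem_preimage, Set.mem_ofPred_eq, if_true, if_false, and_true, and_false, star_zero,
      mul_zero, zero_mul]
    exact prod_mul_star_prod_of_isBalanced h (fun v => (p.2 v : ℂ)) fun i => Circle.norm_coe _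
  simp only [symmetrizationKernel, h1]
  rw [integral_indicator_const _ (measurable_fst MeasurableSet.of_discrete),
    hfst.measureReal_preimage (MeasurableSet.of_discrete (s := E)).nullMeasurableSet]
  simp

theorem exists_perm_comp_eq {α β : Type*} [Finite β] {f g : α → β}
    (h : ∀ i j, f i = f j ↔ g i = g j) : ∃ τ : Equiv.Perm β, τ ∘ f = g := by
  classical
  have := Fintype.ofFinite β
  let F : {v // v ∈ Set.range f} → {v // v ∈ Set.range g} := fun v => ⟨g v.2.choose, _, rfl⟩
  have hF : ∀ i, F ⟨f i, i, rfl⟩ = ⟨g i, i, rfl⟩ := fun i =>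
    Subtype.ext ((h _ _).1 (Exists.choose_spec (⟨i, rfl⟩ : f i ∈ Set.range f)))
  have hbij : Function.Bijective F := by
    constructor
    · rintro ⟨_, i, rfl⟩ ⟨_, j, rfl⟩ hij
      exact Subtype.ext ((h i j).2 (congrArg Subtype.val
        ((hF i).symm.trans (hij.trans (hF j)))))
    · rintro ⟨_, i, rfl⟩
      exact ⟨_, hF i⟩
  refine ⟨(Equiv.ofBijective F hbij).extendSubtype, funext fun i => ?_⟩
  rw [Function.comp_apply, Equiv.extendSubtype_apply_of_mem _ _ ⟨i, rfl⟩]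
  exact congrArg Subtype.val (hF i)

theorem exists_perm_of_pattern_eq {k N : ℕ} {x y x' y' : Fin k → Fin N}
    (h : pattern x y = pattern x' y') : ∃ τ : Equiv.Perm (Fin N), τ ∘ x = x' ∧ τ ∘ y = y' := by
  obtain ⟨τ, hτ⟩ := exists_perm_comp_eq (f := Sum.elim x y) (g := Sum.elim x' y')
    fun i j => Iff.of_eq (congrFun (congrFun h i) j)
  exact ⟨τ, funext fun i => congrFun hτ (Sum.inl i), funext fun i => congrFun hτ (Sum.inr i)⟩

theorem pattern_comp_perm {k N : ℕ} (σ : Equiv.Perm (Fin N)) (x y : Fin k → Fin N) :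
    pattern (σ ∘ x) (σ ∘ y) = pattern x y := by
  have : Sum.elim (σ ∘ x) (σ ∘ y) = σ ∘ Sum.elim x y := (Sum.comp_elim _ _ _).symm
  ext p q
  simp [pattern, this]

open Classical in
/-- The pairs of basis indices with a given pattern. -/
def patternClass (k N : ℕ) (c : Fin k ⊕ Fin k → Fin k ⊕ Fin k → Prop) :
    Finset ((Fin k → Fin N) × (Fin k → Fin N)) :=
  Finset.univ.filter fun z => pattern z.1 z.2 = c

theorem mem_patternClass {k N : ℕ} {c : Fin k ⊕ Fin k → Fin k ⊕ Fin k → Prop}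
    {z : (Fin k → Fin N) × (Fin k → Fin N)} : z ∈ patternClass k N c ↔ pattern z.1 z.2 = c := by
  simp [patternClass]

open Classical in
/-- A uniformly random permutation moves a pair of tuples to a uniformly random pair with the same
pattern. -/
theorem uniformOn_perm_comp_eq {k N : ℕ} (x y a b : Fin k → Fin N) :
    (uniformOn Set.univ).real {σ : Equiv.Perm (Fin N) | σ ∘ a = x ∧ σ ∘ b = y} =
      if pattern a b = pattern x y then ((patternClass k N (pattern x y)).card : ℝ)⁻¹ else 0 := by
  set μ : Measure (Equiv.Perm (Fin N)) := uniformOn Set.univ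
  set E : (Fin k → Fin N) × (Fin k → Fin N) → Set (Equiv.Perm (Fin N)) :=
    fun z => {σ | σ ∘ a = z.1 ∧ σ ∘ b = z.2} with hE
  change μ.real (E (x, y)) = _
  split_ifs with h
  · have hle : ∀ z ∈ patternClass k N (pattern x y), ∀ z' ∈ patternClass k N (pattern x y),
        μ.real (E z) ≤ μ.real (E z') := by
      intro z hz z' hz'
      rw [mem_patternClass] at hz hz'
      obtain ⟨τ, h1, h2⟩ := exists_perm_of_pattern_eq (hz.trans hz'.symm)
      have hT := measurePreserving_uniformOn_univ (Equiv.mulLeft τ)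
      rw [← hT.measureReal_preimage (MeasurableSet.of_discrete (s := E z')).nullMeasurableSet]
      refine measureReal_mono fun σ hσ => ?_
      simp only [hE, Set.mem_preimage, Set.mem_ofPred_eq, Equiv.coe_mulLeft, Equiv.Perm.coe_mul,
        Function.comp_assoc] at hσ ⊢
      rw [hσ.1, hσ.2]
      exact ⟨h1, h2⟩
    have hxy : (x, y) ∈ patternClass k N (pattern x y) := mem_patternClass.2 rfl
    have hsum : ∑ z ∈ patternClass k N (pattern x y), μ.real (E z) = 1 := by
      rw [← measureReal_biUnion_finset _ fun _ _ => MeasurableSet.of_discrete]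
      · have : ⋃ z ∈ patternClass k N (pattern x y), E z = Set.univ := by
          refine Set.eq_univ_of_forall fun σ => ?_
          simp only [Set.mem_iUnion]
          refine ⟨(σ ∘ a, σ ∘ b), mem_patternClass.2 ?_, rfl, rfl⟩
          rw [pattern_comp_perm, h]
        rw [this, probReal_univ]
      · intro z _ z' _ hzz'
        refine Set.disjoint_left.2 fun σ hσ hσ' => hzz' ?_
        exact Prod.ext (hσ.1.symm.trans hσ'.1) (hσ.2.symm.trans hσ'.2)
    rw [Finset.sum_congr rfl fun z hz => le_antisymm (hle z hz _ hxy) (hle _ hxy z hz),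
      Finset.sum_const, nsmul_eq_mul] at hsum
    exact eq_inv_of_mul_eq_one_right hsum
  · have : E (x, y) = ∅ := by
      ext σ
      simp only [hE, Set.mem_ofPred_eq, Set.mem_empty_iff_false, iff_false]
      rintro ⟨rfl, rfl⟩
      exact h (pattern_comp_perm σ a b).symm
    rw [this, measureReal_empty]

open Classical in
/-- The symmetrization replaces each entry by its average over the pattern class, and it kills the
entries at unbalanced pairs. -/
theorem symmetrization_apply_eq {k N : ℕ} (X : TensorOp k N) (x y : Fin k → Fin N) :
    symmetrization k N X x y = if IsBalanced (pattern x y) then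
      ((patternClass k N (pattern x y)).card : ℂ)⁻¹ *
        pairing (fun a b => pattern a b = pattern x y) X else 0 := by
  rw [symmetrization_apply]
  split_ifs with h
  · simp only [symmetrizationKernel_of_isBalanced h, uniformOn_perm_comp_eq]
    rw [pairing, Finset.sum_filter, Finset.mul_sum, Fintype.sum_prod_type]
    refine Finset.sum_congr rfl fun a _ => Finset.sum_congr rfl fun b _ => ?_
    split_ifs <;> simp
  · simp [symmetrizationKernel_eq_zero h]

open Classical in
/-- The `0`-`1` matrix of a pattern class. -/
def patternMatrix (k N : ℕ) (c : Fin k ⊕ Fin k → Fin k ⊕ Fin k → Prop) : TensorOp k N :=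
  Matrix.of fun x y => if pattern x y = c then 1 else 0

open Classical in
theorem symmetrization_eq_sum {k N : ℕ} (X : TensorOp k N) :
    symmetrization k N X = ∑ c : {c : Fin k ⊕ Fin k → Fin k ⊕ Fin k → Prop // IsBalanced c},
      (((patternClass k N c.1).card : ℂ)⁻¹ * pairing (fun a b => pattern a b = c.1) X) •
        patternMatrix k N c.1 := by
  ext x y
  rw [symmetrization_apply_eq, Matrix.sum_apply]
  simp only [Matrix.smul_apply, patternMatrix, Matrix.of_apply, smul_eq_mul, mul_ite, mul_one,
    mul_zero]
  split_ifs with h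
  · rw [Finset.sum_eq_single ⟨pattern x y, h⟩]
    · simp
    · rintro ⟨c, hc⟩ _ hne
      exact if_neg fun e => hne (Subtype.ext e.symm)
    · simp
  · exact (Finset.sum_eq_zero fun c _ => if_neg fun e => h (by rw [e]; exact c.2)).symm

theorem pairing_sum_smul {ι α : Type*} [Fintype ι] [Fintype α] (P : ι → ι → Prop)
    (g : α → ℂ) (X : α → Matrix ι ι ℂ) :
    pairing P (∑ i, g i • X i) = ∑ i, g i * pairing P (X i) := by
  simp only [pairing, Matrix.sum_apply, Matrix.smul_apply, smul_eq_mul, Finset.mul_sum]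
  exact Finset.sum_comm

theorem pairing_sub {ι : Type*} [Fintype ι] (P : ι → ι → Prop) (X Y : Matrix ι ι ℂ) :
    pairing P (X - Y) = pairing P X - pairing P Y := by
  simp [pairing]

/-! ### Comparison of the mixed moments -/

theorem pairing_mixedMomentMap_patternMatrix {m ℓ k N : ℕ} (w : Fin ℓ → FreeGroup (Fin m))
    (j : Fin (k + k) → Fin ℓ) (c c' : Fin k ⊕ Fin k → Fin k ⊕ Fin k → Prop) :
    pairing (fun x y => pattern x y = c')
        (mixedMomentMap (iidLaw m N) (evalWords w) j (patternMatrix k N c)) =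
      ∑ z ∈ patternClass k N c, ∫ Z, classSum (evalWords w Z) (fun i => j (Fin.castAdd k i))
        (fun i => j (Fin.natAdd k i)) z.1 z.2 c' ∂(iidLaw m N) := by
  classical
  have h1 : ∀ x y, mixedMomentMap (iidLaw m N) (evalWords w) j (patternMatrix k N c) x y =
      ∑ z ∈ patternClass k N c, ∫ Z, tensor (fun i => evalWords w Z (j (Fin.castAdd k i))) x z.1 *
        star (tensor (fun i => evalWords w Z (j (Fin.natAdd k i))) y z.2) ∂(iidLaw m N) := by
    intro x y
    rw [patternClass, Finset.sum_filter, Fintype.sum_prod_type]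
    refine Finset.sum_congr rfl fun a _ => Finset.sum_congr rfl fun b _ => ?_
    simp [patternMatrix]
  simp only [pairing, h1]
  rw [Finset.sum_comm]
  refine Finset.sum_congr rfl fun z _ => ?_
  simp only [classSum]
  rw [integral_finsetSum _ fun _ _ => integrable_tensor_mul_star w _ _ _ _ _ _]

open Classical in
/-- The words of the replacements: the `i`-th generator if `w_i` is nontrivial, and the trivial word
otherwise. -/
def replacementWords {m ℓ : ℕ} (w : Fin ℓ → FreeGroup (Fin m)) (i : Fin ℓ) :
    FreeGroup (Fin ℓ) :=
  if w i = 1 then 1 else FreeGroup.of i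

theorem injective_replacementWords {m ℓ : ℕ} {w : Fin ℓ → FreeGroup (Fin m)}
    (hw : Function.Injective w) : Function.Injective (replacementWords w) := by
  intro i i' h
  unfold replacementWords at h
  split_ifs at h with h1 h2 h2
  · exact hw (h1.trans h2.symm)
  · exact absurd h.symm (FreeGroup.of_ne_one _)
  · exact absurd h (FreeGroup.of_ne_one _)
  · exact FreeGroup.of_injective h

theorem replaceWords_eq {m ℓ N : ℕ} (w : Fin ℓ → FreeGroup (Fin m)) :
    replaceWords (N := N) w = evalWords (replacementWords w) := by
  ext Z i x a
  unfold replaceWords evalWords replacementWords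
  split_ifs
  · simp
  · rw [FreeGroup.lift_apply_of]; rfl

/-- The coefficients of the symmetrized difference are small: for each starting pair in the class
`c`, the class sums of both models are close to the same number, and the coefficient is the mean
over `c` of their difference. -/
theorem norm_pairing_sub_le {m ℓ k N : ℕ} {w : Fin ℓ → FreeGroup (Fin m)}
    (hw : Function.Injective w) (j : Fin (k + k) → Fin ℓ)
    {c' : Fin k ⊕ Fin k → Fin k ⊕ Fin k → Prop} (hc' : IsBalanced c')
    (c : Fin k ⊕ Fin k → Fin k ⊕ Fin k → Prop) :
    ‖((patternClass k N c).card : ℂ)⁻¹ * pairing (fun x y => pattern x y = c')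
      ((mixedMomentMap (iidLaw m N) (evalWords w) j -
        mixedMomentMap (iidLaw ℓ N) (replaceWords w) j) (patternMatrix k N c))‖ ≤
      2 * coincidenceBound w (fun i => j (Fin.castAdd k i)) (fun i => j (Fin.natAdd k i)) N +
      2 * coincidenceBound (replacementWords w) (fun i => j (Fin.castAdd k i))
        (fun i => j (Fin.natAdd k i)) N := by
  set s := fun i => j (Fin.castAdd k i)
  set t := fun i => j (Fin.natAdd k i)
  set ε := 2 * coincidenceBound w s t N + 2 * coincidenceBound (replacementWords w) s t N with hε
  have hcb : ∀ {m : ℕ} (w : Fin ℓ → FreeGroup (Fin m)), 0 ≤ coincidenceBound w s t N :=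
    fun w => Finset.sum_nonneg fun _ _ => Finset.sum_nonneg fun _ _ => wordBound_nonneg _ _
  have hε0 : 0 ≤ ε := by
    have := hcb w
    have := hcb (replacementWords w)
    positivity
  rw [LinearMap.sub_apply, pairing_sub, replaceWords_eq, pairing_mixedMomentMap_patternMatrix,
    pairing_mixedMomentMap_patternMatrix, ← Finset.sum_sub_distrib, norm_mul, norm_inv,
    Complex.norm_natCast]
  have h1 : ∀ z ∈ patternClass k N c,
      ‖(∫ Z, classSum (evalWords w Z) s t z.1 z.2 c' ∂(iidLaw m N)) -
        ∫ Z, classSum (evalWords (replacementWords w) Z) s t z.1 z.2 c' ∂(iidLaw ℓ N)‖ ≤ ε := by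
    intro z _
    refine (norm_sub_le_norm_sub_add_norm_sub _ _ _).trans (add_le_add
      (norm_integral_classSum_sub_le hw s t z.1 z.2 hc') ?_)
    rw [norm_sub_rev]
    exact norm_integral_classSum_sub_le (injective_replacementWords hw) s t z.1 z.2 hc'
  have h2 := norm_sum_le_of_le _ h1
  rw [Finset.sum_const, nsmul_eq_mul] at h2
  refine (mul_le_mul_of_nonneg_left h2 (by positivity)).trans ?_
  rw [← mul_assoc]
  exact mul_le_of_le_one_left hε0 inv_mul_le_one

open Classical in
/-- Both outer factors expand over the balanced pattern classes, and the coefficient of the pair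
`(c', c)` is `|c|⁻¹ tr (O_{c'}ᵀ Δ(O_c))`. -/
theorem diamondNorm_symmetrized_le {k N : ℕ} (Δ : TensorOp k N →ₗ[ℂ] TensorOp k N) {ε : ℝ}
    (hΔ : ∀ c c' : Fin k ⊕ Fin k → Fin k ⊕ Fin k → Prop, IsBalanced c' →
      ‖((patternClass k N c).card : ℂ)⁻¹ * pairing (fun x y => pattern x y = c')
        (Δ (patternMatrix k N c))‖ ≤ ε) :
    diamondNorm (symmetrization k N ∘ₗ Δ ∘ₗ symmetrization k N) ≤
      ENNReal.ofReal (∑ _i : {c : Fin k ⊕ Fin k → Fin k ⊕ Fin k → Prop // IsBalanced c} ×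
        {c : Fin k ⊕ Fin k → Fin k ⊕ Fin k → Prop // IsBalanced c}, ε) := by
  refine (diamondNorm_le_sum _
    (fun i : {c : Fin k ⊕ Fin k → Fin k ⊕ Fin k → Prop // IsBalanced c} ×
      {c : Fin k ⊕ Fin k → Fin k ⊕ Fin k → Prop // IsBalanced c} =>
      ((patternClass k N i.2.1).card : ℂ)⁻¹ * pairing (fun x y => pattern x y = i.1.1)
        (Δ (patternMatrix k N i.2.1)))
    (fun i x y => pattern x y = i.2.1) (fun i x y => pattern x y = i.1.1)
    (fun i => isPartialMatching_of_isBalanced i.2.2) fun X x y => ?_).trans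
    (ENNReal.ofReal_le_ofReal (Finset.sum_le_sum fun i _ => hΔ _ _ i.1.2))
  rw [LinearMap.comp_apply, LinearMap.comp_apply, symmetrization_eq_sum (Δ _),
    symmetrization_eq_sum X, Matrix.sum_apply, Fintype.sum_prod_type]
  refine Finset.sum_congr rfl fun c' _ => ?_
  rw [map_sum]
  simp only [map_smul]
  rw [pairing_sum_smul, Matrix.smul_apply, smul_eq_mul, Finset.mul_sum, Finset.sum_mul]
  refine Finset.sum_congr rfl fun c _ => ?_
  have hM : patternMatrix k N c'.1 x y = if pattern x y = c'.1 then 1 else 0 := by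
    rw [patternMatrix, Matrix.of_apply]
  rw [hM, patternClass]
  split_ifs with h
  · ring
  · simp

end PhasedFreeness

end

theorem mainTheorem6 (m ℓ k : ℕ) (w : Fin ℓ → FreeGroup (Fin m)) (hw : Function.Injective w)
    (j : Fin (k + k) → Fin ℓ) :
    Tendsto
      (fun N : ℕ => PhasedFreeness.diamondNorm
        (PhasedFreeness.symmetrization k N ∘ₗ
          (PhasedFreeness.mixedMomentMap (PhasedFreeness.iidLaw m N)
              (PhasedFreeness.evalWords w) j -
            PhasedFreeness.mixedMomentMap (PhasedFreeness.iidLaw ℓ N)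
              (PhasedFreeness.replaceWords w) j) ∘ₗ
          PhasedFreeness.symmetrization k N))
      atTop (𝓝 0) := by
  classical
  refine tendsto_of_tendsto_of_tendsto_of_le_of_le tendsto_const_nhds ?_
    (fun _ => zero_le) fun N => PhasedFreeness.diamondNorm_symmetrized_le _
      fun c c' hc' => PhasedFreeness.norm_pairing_sub_le hw j hc' c
  rw [← ENNReal.ofReal_zero]
  refine ENNReal.tendsto_ofReal ?_
  have h := ((PhasedFreeness.tendsto_coincidenceBound w (fun i => j (Fin.castAdd k i))
    (fun i => j (Fin.natAdd k i))).const_mul 2).add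
    ((PhasedFreeness.tendsto_coincidenceBound (PhasedFreeness.replacementWords w)
      (fun i => j (Fin.castAdd k i)) (fun i => j (Fin.natAdd k i))).const_mul 2)
  rw [mul_zero, add_zero] at h
  simp only [Finset.sum_const, nsmul_eq_mul]
  simpa only [mul_zero] using h.const_mul _
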